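/- Let $\mathcal H$ be the rational quaternion algebra with basis $1,I,J,IJ$, $I^2=J^2=-1$, $IJ=-JI$, with reduced norm $\mathrm{Nm}$, and let $\mathcal O\subset\mathcal H$ be the Hurwitz order, with $\mathbb Z$-basis $1,\ I,\ J,\ \tfrac12(1+I+J+IJ)$. Let $S$ be a finite (possibly empty) set of odd primes, $\mathcal O_S=\mathcal O\otimes\mathbb Z[1/p : p\in S]$, $\Gamma_S=\mathcal O_S^*$, and let $\overline\Gamma_S$ be the quotient of $\Gamma_S$ by its subgroup of scalars. Write $\overline x$ for the image in $\overline\Gamma_S$ of $x\in\Gamma_S$ and $\overline{\mathcal O}^*$ for the image of $\mathcal O^*$. For each $p\in S$ fix an isomorphism $\mathcal H\otimes\mathbb Q_p\cong \mathrm M_2(\mathbb Q_p)$ that identifies $\mathcal O\otimes\mathbb Z_p$ with $\mathrm M_2(\mathbb Z_p)$; through it $\Gamma_S$ acts on the Bruhat–Tits tree $\mathfrak X_p$ of $\mathrm{PGL}_2(\mathbb Q_p)$, whose vertices are the homothety classes of $\mathbb Z_p$-lattices in $\mathbb Q_p^2$. Let $v_{0,p}$ be the class of $\mathbb Z_p\oplus\mathbb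 Z_p$ and $N(v_{0,p})$ the set of its neighbours. For $p\in S$, a *system of representatives at $p$* is a subset of $\overline\Gamma_S$ that consists of exactly one element $\overline x$ for each $v\in N(v_{0,p})$, where $\overline x$ has a representative $x\in\mathcal O$ with $\mathrm{Nm}(x)=p$ and $x\,v_{0,p}=v$. Call it *two-sided* if it also contains exactly one element of $\overline{\mathcal O}^*\,\overline x$ for every $x\in\mathcal O$ with $\mathrm{Nm}(x)=p$. Then: (i) $\overline{\mathcal O}^*\cong A_4$, so it has $11$ nontrivial elements. (ii) For $p\in S$, a subset of $\overline\Gamma_S$ is a system of representatives at $p$ if and only if it consists of the class of exactly one element from each orbit $x\mathcal O^*$ of the right action of $\mathcal O^*$ on the elements of $\mathcal O$ of reduced norm $p$. Every such system has $p+1$ elements. For every $p\in S$ two-sided systems exist. (iii) For each $p\in S$ let any system of representatives $A_p$ at $p$ be given. Put $A_0=\overline{\mathcal O}^*\setminus\{1\}$. Take one generator $a_{\overline x}$ for each $\overline x\in A_0\cup\bigcup_{p\in S}A_p$, and write $a_{1}$ for the identity of the free group on these generators. Then $a_{\overline x}\mapsto\overline x$ induces an isomorphism onto $\overline\Gamma_S$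 from the group with these generators and all relations of the following four types: 1. $a_{\overline\sigma}a_{\overline\tau}a_{\overline\nu}^{-1}=1$ when $\overline\sigma,\overline\tau,\overline\nu\in A_0$ and $\overline\sigma\,\overline\tau=\overline\nu$; 2. $a_{\overline\sigma}a_{\overline\tau}a_{\overline\nu}^{-1}=1$ when $\overline\sigma,\overline\tau\in A_p$ for some $p\in S$, $\overline\nu\in\overline{\mathcal O}^*=A_0\cup\{1\}$ and $\overline\sigma\,\overline\tau=\overline\nu$; 3. $a_{\overline\sigma}a_{\overline\tau}(a_{\overline\alpha}a_{\overline\beta}a_{\overline\nu})^{-1}=1$ when $\overline\sigma,\overline\beta\in A_p$ and $\overline\tau,\overline\alpha\in A_q$ for some $p,q\in S$ with $q<p$, $\overline\nu\in\overline{\mathcal O}^*$ and $\overline\sigma\,\overline\tau=\overline\alpha\,\overline\beta\,\overline\nu$; 4. $a_{\overline\nu}a_{\overline\sigma}(a_{\overline\tau}a_{\overline\mu})^{-1}=1$ when $\overline\sigma,\overline\tau\in A_p$ for some $p\in S$, $\overline\nu,\overline\mu\in\overline{\mathcal O}^*$ and $\overline\nu\,\overline\sigma=\overline\tau\,\overline\mu$.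 (iv) If every $A_p$ is two-sided, then the same holds with type 3 replaced by: $a_{\overline\sigma}a_{\overline\tau}(a_{\overline\nu}a_{\overline\alpha}a_{\overline\beta})^{-1}=1$ when $\overline\sigma,\overline\beta\in A_p$ and $\overline\tau,\overline\alpha\in A_q$ for some $p,q\in S$ with $q<p$, $\overline\nu\in\overline{\mathcal O}^*$ and $\overline\sigma\,\overline\tau=\overline\nu\,\overline\alpha\,\overline\beta$. -/

import Mathlib

open scoped Quaternion TensorProduct Pointwise

noncomputable section

namespace SUnit

/-! ### The Hurwitz order, the `S`-order and the projective `S`-unit group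

`ℍ[ℚ]` is the rational quaternion algebra with `I ^ 2 = J ^ 2 = -1`, `I * J = -J * I`; its
reduced norm is `Quaternion.normSq`. -/

/-- The quaternion `I`. -/
def qI : ℍ[ℚ] := ⟨0, 1, 0, 0⟩

/-- The quaternion `J`. -/
def qJ : ℍ[ℚ] := ⟨0, 0, 1, 0⟩

/-- The quaternion `(1 + I + J + I J) / 2`. -/
def qW : ℍ[ℚ] := ⟨1 / 2, 1 / 2, 1 / 2, 1 / 2⟩

/-- The Hurwitz order: the `ℤ`-span of `1`, `I`, `J` and `(1 + I + J + I J) / 2`. -/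
def hurwitz : Subring ℍ[ℚ] where
  carrier := {x | ∃ a b c d : ℤ,
    x = a • (1 : ℍ[ℚ]) + b • qI + c • qJ + d • qW}
  mul_mem' := by
    rintro _ _ ⟨a, b, c, d, rfl⟩ ⟨e, f, g, h, rfl⟩
    refine ⟨a * e - b * f - b * g - b * h + c * f - c * g - d * g - d * h,
      a * f + b * e - b * g + c * f + c * h + d * f - d * g,
      a * g - b * g - b * h + c * e + c * f + c * h + d * f,
      a * h + b * g + b * g + b * h - c * f - c * f - c * h + d * e - d * f + d * g + d * h, ?_⟩
    ext <;> simp [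
      show qI.re = 0 from rfl, show qI.imI = 1 from rfl, show qI.imJ = 0 from rfl,
      show qI.imK = 0 from rfl, show qJ.re = 0 from rfl, show qJ.imI = 0 from rfl,
      show qJ.imJ = 1 from rfl, show qJ.imK = 0 from rfl, show qW.re = 1 / 2 from rfl,
      show qW.imI = 1 / 2 from rfl, show qW.imJ = 1 / 2 from rfl, show qW.imK = 1 / 2 from rfl] <;> ring
  one_mem' := ⟨1, 0, 0, 0, by simp⟩
  add_mem' := by
    rintro _ _ ⟨a, b, c, d, rfl⟩ ⟨e, f, g, h, rfl⟩
    exact ⟨a + e, b + f, c + g, d + h, by simp only [add_smul]; abel⟩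
  zero_mem' := ⟨0, 0, 0, 0, by simp⟩
  neg_mem' := by
    rintro _ ⟨a, b, c, d, rfl⟩
    exact ⟨-a, -b, -c, -d, by simp only [neg_smul]; abel⟩

/-- `m_S`, the product of the primes in `S`. -/
def mS (S : Finset Nat.Primes) : ℕ := ∏ p ∈ S, (p : ℕ)

/-- The `S`-order `𝒪_S = 𝒪 ⊗ ℤ[1/p : p ∈ S]`, as the subring of all quaternions
`x / m_S ^ n` with `x ∈ 𝒪`. -/
def sOrder (S : Finset Nat.Primes) : Subring ℍ[ℚ] where
  carrier := {x | ∃ n : ℕ, (mS S ^ n) • x ∈ hurwitz}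
  mul_mem' := by
    rintro x y ⟨n, hn⟩ ⟨k, hk⟩
    refine ⟨n + k, ?_⟩
    have h := hurwitz.mul_mem hn hk
    rwa [smul_mul_smul_comm, ← pow_add] at h
  one_mem' := ⟨0, by simp⟩
  add_mem' := by
    rintro x y ⟨n, hn⟩ ⟨k, hk⟩
    refine ⟨n + k, ?_⟩
    have h := hurwitz.add_mem (hurwitz.nsmul_mem hn (mS S ^ k)) (hurwitz.nsmul_mem hk (mS S ^ n))
    rw [smul_smul, smul_smul, ← pow_add, ← pow_add, add_comm k n, ← smul_add] at h
    exact h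
  zero_mem' := ⟨0, by simp⟩
  neg_mem' := by
    rintro x ⟨n, hn⟩
    exact ⟨n, by simpa using hurwitz.neg_mem hn⟩

lemma hurwitz_le_sOrder (S : Finset Nat.Primes) : hurwitz ≤ sOrder S :=
  fun x hx => ⟨0, by simpa using hx⟩

/-- The `S`-unit group `Γ_S`. -/
abbrev Gam (S : Finset Nat.Primes) : Type := (sOrder S)ˣ

/-- The quaternion underlying an element of `Γ_S`. -/
def quat {S : Finset Nat.Primes} (g : Gam S) : ℍ[ℚ] := ((g : sOrder S) : ℍ[ℚ])

/-- The subgroup of scalars in `Γ_S`. -/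
def scalars (S : Finset Nat.Primes) : Subgroup (Gam S) where
  carrier := {g | ∃ c : ℚ, quat g = algebraMap ℚ ℍ[ℚ] c}
  mul_mem' := by
    rintro x y ⟨c, hc⟩ ⟨d, hd⟩
    exact ⟨c * d, (congrArg₂ (· * ·) hc hd).trans (map_mul (algebraMap ℚ ℍ[ℚ]) c d).symm⟩
  one_mem' := ⟨1, by simp [quat]⟩
  inv_mem' := by
    rintro x ⟨c, hc⟩
    refine ⟨c⁻¹, ?_⟩
    have h : quat x * quat x⁻¹ = 1 := congrArg Subtype.val x.mul_inv
    rw [eq_inv_of_mul_eq_one_right h, hc, map_inv₀]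

instance scalars_normal (S : Finset Nat.Primes) : (scalars S).Normal where
  conj_mem := by
    rintro x ⟨c, hc⟩ g
    refine ⟨c, ?_⟩
    have h : quat g * quat g⁻¹ = 1 := congrArg Subtype.val g.mul_inv
    have e : quat (g * x * g⁻¹) = quat g * quat x * quat g⁻¹ := rfl
    rw [e, hc, ← Algebra.commutes c (quat g), mul_assoc, h, mul_one]

/-- `Γ̄_S`, the group of `S`-units modulo scalars. -/
abbrev GamBar (S : Finset Nat.Primes) : Type := Gam S ⧸ scalars S

/-- The class in `Γ̄_S` of an element of `Γ_S`. -/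
def bar {S : Finset Nat.Primes} : Gam S →* GamBar S := QuotientGroup.mk' (scalars S)

/-- `Ō^*`, the image of the unit group of the Hurwitz order in `Γ̄_S`. -/
def unitsBar (S : Finset Nat.Primes) : Subgroup (GamBar S) :=
  (bar.comp (Units.map (Subring.inclusion (hurwitz_le_sOrder S)).toMonoidHom)).range

/-! ### The Bruhat–Tits tree of `PGL₂(ℚ_p)` -/

instance fact_prime (p : Nat.Primes) : Fact (p : ℕ).Prime := ⟨p.2⟩

section Tree

variable (p : ℕ) [Fact p.Prime]

/-- `ℤ_p`-lattices in `ℚ_p ^ 2`. -/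
abbrev Lat : Type :=
  {L : Submodule ℤ_[p] (Fin 2 → ℚ_[p]) // Submodule.IsLattice ℚ_[p] L}

/-- Two lattices are homothetic if they differ by a nonzero scalar of `ℚ_p`. -/
instance homothety : Setoid (Lat p) where
  r L M := ∃ c : ℚ_[p]ˣ, M.1 = c • L.1
  iseqv :=
    { refl := fun L => ⟨1, by simp⟩
      symm := by
        rintro L M ⟨c, hc⟩
        exact ⟨c⁻¹, by rw [hc, inv_smul_smul]⟩
      trans := by
        rintro L M N ⟨c, hc⟩ ⟨d, hd⟩
        exact ⟨d * c, by rw [hd, hc, smul_smul]⟩ }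

/-- The vertices of the tree: homothety classes of lattices. -/
abbrev Vertex : Type := Quotient (homothety p)

/-- The Bruhat–Tits tree: distinct vertices are adjacent if they are represented by lattices
`L`, `M` with `p L ⊊ M ⊊ L`. -/
def tree : SimpleGraph (Vertex p) :=
  SimpleGraph.fromRel fun v w => ∃ L M : Lat p, Quotient.mk _ L = v ∧ Quotient.mk _ M = w ∧
    (p : ℤ_[p]) • L.1 < M.1 ∧ M.1 < L.1

/-- The standard lattice `ℤ_p ⊕ ℤ_p`. -/
def stdLat : Lat p :=
  ⟨Submodule.span ℤ_[p] (Set.range (Pi.basisFun ℚ_[p] (Fin 2))),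
    ⟨Submodule.fg_span (Set.finite_range _), by
      rw [Submodule.span_span_of_tower, (Pi.basisFun ℚ_[p] (Fin 2)).span_eq]⟩⟩

/-- The base vertex `v_{0,p}`. -/
def baseVertex : Vertex p := Quotient.mk _ (stdLat p)

variable {p}

/-- A matrix in `GL₂(ℚ_p)` acting on `ℚ_p ^ 2`, as a `ℤ_p`-linear map. -/
def glLin (g : GL (Fin 2) ℚ_[p]) : (Fin 2 → ℚ_[p]) →ₗ[ℤ_[p]] (Fin 2 → ℚ_[p]) :=
  (Matrix.toLin' (g : Matrix (Fin 2) (Fin 2) ℚ_[p])).restrictScalars ℤ_[p]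

/-- The image of a lattice under a matrix in `GL₂(ℚ_p)`. -/
def glLat (g : GL (Fin 2) ℚ_[p]) (L : Lat p) : Lat p :=
  ⟨L.1.map (glLin g), by
    obtain ⟨L, hL⟩ := L
    refine ⟨hL.fg.map _, ?_⟩
    have h : Function.Surjective (Matrix.toLin' (g : Matrix (Fin 2) (Fin 2) ℚ_[p])) := by
      intro v
      refine ⟨Matrix.toLin' ((g⁻¹ : GL (Fin 2) ℚ_[p]) : Matrix (Fin 2) (Fin 2) ℚ_[p]) v, ?_⟩
      rw [← Matrix.toLin'_mul_apply, ← Units.val_mul, mul_inv_cancel]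
      simp
    have e : (L.map (glLin g) : Set (Fin 2 → ℚ_[p]))
        = Matrix.toLin' (g : Matrix (Fin 2) (Fin 2) ℚ_[p]) '' (L : Set (Fin 2 → ℚ_[p])) := rfl
    rw [e, Submodule.span_image, hL.span_eq_top, Submodule.map_top, LinearMap.range_eq_top.2 h]⟩

/-- The action of `GL₂(ℚ_p)` on the vertices of the tree. -/
def glVertex (g : GL (Fin 2) ℚ_[p]) : Vertex p → Vertex p :=
  Quotient.map (glLat g) (by
    rintro L M ⟨c, hc⟩
    refine ⟨c, ?_⟩
    ext v
    simp only [glLat, hc, Submodule.mem_map]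
    constructor
    · rintro ⟨_, ⟨y, hy, rfl⟩, rfl⟩
      exact ⟨glLin g y, ⟨y, hy, rfl⟩,
        (map_smul (Matrix.toLin' (g : Matrix (Fin 2) (Fin 2) ℚ_[p])) (c : ℚ_[p]) y).symm⟩
    · rintro ⟨_, ⟨y, hy, rfl⟩, rfl⟩
      exact ⟨c • y, ⟨y, hy, rfl⟩,
        map_smul (Matrix.toLin' (g : Matrix (Fin 2) (Fin 2) ℚ_[p])) (c : ℚ_[p]) y⟩)

variable (p)

/-- An isomorphism `ℋ ⊗ ℚ_p ≅ M₂(ℚ_p)` that identifies `𝒪 ⊗ ℤ_p` with `M₂(ℤ_p)`. -/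
structure LocalSplitting where
  /-- the isomorphism -/
  equiv : (ℚ_[p] ⊗[ℚ] ℍ[ℚ]) ≃ₐ[ℚ_[p]] Matrix (Fin 2) (Fin 2) ℚ_[p]
  map_order : ∀ M : Matrix (Fin 2) (Fin 2) ℚ_[p],
    M ∈ Submodule.span ℤ_[p] ((fun x : ℍ[ℚ] => equiv (1 ⊗ₜ x)) '' (hurwitz : Set ℍ[ℚ])) ↔
      ∀ i j, ∃ z : ℤ_[p], M i j = z

variable {p}

/-- The homomorphism `Γ_S → GL₂(ℚ_p)` given by a local splitting. -/
def LocalSplitting.toGL (φ : LocalSplitting p) (S : Finset Nat.Primes) :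
    Gam S →* GL (Fin 2) ℚ_[p] :=
  Units.map ((((φ.equiv : (ℚ_[p] ⊗[ℚ] ℍ[ℚ]) →+* Matrix (Fin 2) (Fin 2) ℚ_[p]).comp
    (Algebra.TensorProduct.includeRight : ℍ[ℚ] →ₐ[ℚ] ℚ_[p] ⊗[ℚ] ℍ[ℚ]).toRingHom).comp
      (sOrder S).subtype).toMonoidHom)

end Tree

/-! ### The generators and the relations -/

section Presentation

variable {S : Finset Nat.Primes}

/-- The set of elements of `Γ_S` that lie in the Hurwitz order and have reduced norm `p`. -/
def normSet (S : Finset Nat.Primes) (p : ℕ) : Set (Gam S) :=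
  {g | quat g ∈ hurwitz ∧ Quaternion.normSq (quat g) = (p : ℚ)}

/-- `x` has a representative in `𝒪` of reduced norm `p` that maps `v_{0,p}` to `v`. -/
def Moves {p : ℕ} [Fact p.Prime] (φ : LocalSplitting p) (x : GamBar S) (v : Vertex p) : Prop :=
  ∃ g ∈ normSet S p, bar g = x ∧ glVertex (φ.toGL S g) (baseVertex p) = v

/-- `A` consists of exactly one `x` for each neighbour `v` of `v_{0,p}`, where `x` has a
representative in `𝒪` of reduced norm `p` and maps `v_{0,p}` to `v`. -/
def IsNeighbourSystem {p : ℕ} [Fact p.Prime] (φ : LocalSplitting p) (A : Set (GamBar S)) : Prop :=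
  (∀ x ∈ A, ∃ v ∈ (tree p).neighborSet (baseVertex p), Moves φ x v) ∧
    ∀ v ∈ (tree p).neighborSet (baseVertex p), ∃! x, x ∈ A ∧ Moves φ x v

/-- `A` consists of (the class of) exactly one element from each orbit `g 𝒪^*` of the right
action of `𝒪^*` on the elements of `𝒪` of reduced norm `p`. -/
def IsRightOrbitSystem (p : ℕ) (A : Set (GamBar S)) : Prop :=
  A ⊆ bar '' normSet S p ∧
    ∀ g ∈ normSet S p, ∃! x, x ∈ A ∧ ∃ u ∈ unitsBar S, x = bar g * u

/-- `A` consists of (the class of) exactly one element from each orbit `𝒪^* g` of the left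
action of `𝒪^*` on the elements of `𝒪` of reduced norm `p`. -/
def IsLeftOrbitSystem (p : ℕ) (A : Set (GamBar S)) : Prop :=
  A ⊆ bar '' normSet S p ∧
    ∀ g ∈ normSet S p, ∃! x, x ∈ A ∧ ∃ u ∈ unitsBar S, x = u * bar g

/-- `A₀`, indexed by the nontrivial elements of `Ō^*`. -/
def A0 (S : Finset Nat.Primes) : Set (GamBar S) := {x | x ∈ unitsBar S ∧ x ≠ 1}

/-- The index set of the generators `A' = A₀ ∪ ⋃ A_p`. -/
def gens (A : S → Set (GamBar S)) : Set (GamBar S) := A0 S ∪ ⋃ p : S, A p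

open Classical in
/-- The generator `a_x` for `x` in the index set, with the convention `a_1 = 1` (only used for
`x ∈ A'` and for `x = 1`). -/
def letter (A : S → Set (GamBar S)) (x : GamBar S) : FreeGroup (gens A) :=
  if h : x ∈ gens A then FreeGroup.of ⟨x, h⟩ else 1

/-- Type (1): products within `A₀`. -/
def rel1 (A : S → Set (GamBar S)) : Set (FreeGroup (gens A)) :=
  {r | ∃ σ ∈ A0 S, ∃ τ ∈ A0 S, ∃ ν ∈ A0 S, σ * τ = ν ∧
    r = letter A σ * letter A τ * (letter A ν)⁻¹}

/-- Type (2): products of two elements of `A_p` landing in `Ō^* = A₀ ∪ {1}`. -/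
def rel2 (A : S → Set (GamBar S)) : Set (FreeGroup (gens A)) :=
  {r | ∃ p : S, ∃ σ ∈ A p, ∃ τ ∈ A p, ∃ ν ∈ unitsBar S, σ * τ = ν ∧
    r = letter A σ * letter A τ * (letter A ν)⁻¹}

/-- Type (3), unit on the right: `σ τ = α β ν`. -/
def rel3Right (A : S → Set (GamBar S)) : Set (FreeGroup (gens A)) :=
  {r | ∃ p q : S, (q : Nat.Primes).1 < (p : Nat.Primes).1 ∧ ∃ σ ∈ A p, ∃ β ∈ A p, ∃ τ ∈ A q, ∃ α ∈ A q, ∃ ν ∈ unitsBar S,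
    σ * τ = α * β * ν ∧
    r = letter A σ * letter A τ * (letter A α * letter A β * letter A ν)⁻¹}

/-- Type (3), unit on the left: `σ τ = ν α β`. -/
def rel3Left (A : S → Set (GamBar S)) : Set (FreeGroup (gens A)) :=
  {r | ∃ p q : S, (q : Nat.Primes).1 < (p : Nat.Primes).1 ∧ ∃ σ ∈ A p, ∃ β ∈ A p, ∃ τ ∈ A q, ∃ α ∈ A q, ∃ ν ∈ unitsBar S,
    σ * τ = ν * α * β ∧
    r = letter A σ * letter A τ * (letter A ν * letter A α * letter A β)⁻¹}

/-- Type (4): moving `A₀` past `A_p`, `ν σ = τ μ`, where `ν` and `μ` are in `A₀ ∪ {1}`. -/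
def rel4 (A : S → Set (GamBar S)) : Set (FreeGroup (gens A)) :=
  {r | ∃ p : S, ∃ σ ∈ A p, ∃ τ ∈ A p, ∃ ν ∈ unitsBar S, ∃ μ ∈ unitsBar S, ν * σ = τ * μ ∧
    r = letter A ν * letter A σ * (letter A τ * letter A μ)⁻¹}

/-- The group with generators `A'` and relations `R` is `Γ̄_S`, through `a_x ↦ x`. -/
def Presents (A : S → Set (GamBar S)) (R : Set (FreeGroup (gens A))) : Prop :=
  ∃ e : PresentedGroup R ≃* GamBar S, ∀ x : gens A, e (PresentedGroup.of x) = x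

end Presentation

end SUnit

end

noncomputable section
namespace SUnit

open Quaternion

/-! ### Arithmetic of the Hurwitz order -/

/-! The arithmetic input is that the Hurwitz order is norm-Euclidean, so its right ideals are
principal (`exists_generator`). Hence an element whose norm is divisible by `p`, but which is not
itself divisible by `p`, splits off a left factor of norm `p` (`exists_left_factor`). Three facts
follow. Units and elements of norm `p ∈ S` generate `Γ̄_S` (`closure_eq_top`). A product of elements
of norms `p` and `q` can be rewritten with the norms in the other order (`exists_exchange`). A
product of elements of norm `p` is divisible by `p` only if two adjacent factors already are
(`not_dvd_prod`), which is the algebraic form of "a path without backtracking in a tree is not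
closed". The last fact shows that a nonempty word sorted by primes and without cancellation is never
a unit (`word_eq_nil`).

For the presentation, let `E` be the abstract group, `H` the image in it of `Ō^*`, and `Y_p` the
products of a generator from `A_p` with an element of `H`. Type 1 makes `H` a copy of `Ō^*`, type 4
gives `H Y_p ⊆ Y_p`, type 2 gives inverses and lifts cancellations from `Γ̄_S` to `E`, and type 3
sorts words. A shortest sorted word for an element of the kernel then has no cancellation in `Γ̄_S`,
so it is empty by `word_eq_nil`; the element lies in `H`, where the map is injective
(`injective_of_words`, `presents_of_exchange`).

The tree enters only in comparing systems of representatives. Neighbours of the base vertex are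
lattices strictly between `p L` and `L`. The elements of the order carrying `L` into such a lattice
form a right ideal, whose generator has norm `p` and is unique up to right units
(`exists_hom_image_eq`, `glVertex_eq_iff`). Reduction modulo `p` turns these lattices into lines in
a plane over the field with `p` elements, whence `p + 1`. Two-sided systems come from Hall's
marriage theorem, and `A₄` from conjugation on the vertices of a tetrahedron. -/

lemma mem_hurwitz_iff {x : ℍ[ℚ]} : x ∈ hurwitz ↔ ∃ a b c d : ℤ,
    x.re = a + d / 2 ∧ x.imI = b + d / 2 ∧ x.imJ = c + d / 2 ∧ x.imK = d / 2 := by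
  have key : ∀ a b c d : ℤ, x = a • (1 : ℍ[ℚ]) + b • qI + c • qJ + d • qW ↔
      x.re = a + d / 2 ∧ x.imI = b + d / 2 ∧ x.imJ = c + d / 2 ∧ x.imK = d / 2 := by
    intro a b c d
    rw [Quaternion.ext_iff]
    simp [show qI.re = 0 from rfl, show qI.imI = 1 from rfl, show qI.imJ = 0 from rfl,
      show qI.imK = 0 from rfl, show qJ.re = 0 from rfl, show qJ.imI = 0 from rfl,
      show qJ.imJ = 1 from rfl, show qJ.imK = 0 from rfl, show qW.re = 1 / 2 from rfl,
      show qW.imI = 1 / 2 from rfl, show qW.imJ = 1 / 2 from rfl, show qW.imK = 1 / 2 from rfl,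
      div_eq_mul_inv]
  simp only [← key]
  rfl

lemma star_mem_hurwitz {x : ℍ[ℚ]} (hx : x ∈ hurwitz) : star x ∈ hurwitz := by
  obtain ⟨a, b, c, d, h1, h2, h3, h4⟩ := mem_hurwitz_iff.1 hx
  refine mem_hurwitz_iff.2 ⟨a + d, -b, -c, -d, ?_, ?_, ?_, ?_⟩ <;>
    simp [h1, h2, h3, h4] <;> ring

lemma exists_normSq_eq {x : ℍ[ℚ]} (hx : x ∈ hurwitz) : ∃ n : ℕ, normSq x = n := by
  obtain ⟨a, b, c, d, h1, h2, h3, h4⟩ := mem_hurwitz_iff.1 hx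
  have h : normSq x = ((a ^ 2 + b ^ 2 + c ^ 2 + d ^ 2 + a * d + b * d + c * d : ℤ) : ℚ) := by
    rw [normSq_def', h1, h2, h3, h4]
    push_cast
    ring
  have h0 : 0 ≤ a ^ 2 + b ^ 2 + c ^ 2 + d ^ 2 + a * d + b * d + c * d := by
    have := normSq_nonneg (a := x)
    rw [h] at this
    exact_mod_cast this
  refine ⟨(a ^ 2 + b ^ 2 + c ^ 2 + d ^ 2 + a * d + b * d + c * d).toNat, ?_⟩
  rw [h, ← Int.cast_natCast, Int.toNat_of_nonneg h0]

lemma exists_trace_eq {x : ℍ[ℚ]} (hx : x ∈ hurwitz) : ∃ n : ℤ, 2 * x.re = n := by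
  obtain ⟨a, b, c, d, h1, -⟩ := mem_hurwitz_iff.1 hx
  exact ⟨2 * a + d, by rw [h1]; push_cast; ring⟩

lemma natCast_mul_comm (n : ℕ) (x : ℍ[ℚ]) : (n : ℍ[ℚ]) * x = x * n := (Nat.cast_commute n x).eq

lemma mul_star_eq {x : ℍ[ℚ]} {n : ℕ} (h : normSq x = n) : x * star x = (n : ℍ[ℚ]) := by
  rw [self_mul_star, h, coe_natCast]

lemma star_mul_eq {x : ℍ[ℚ]} {n : ℕ} (h : normSq x = n) : star x * x = (n : ℍ[ℚ]) := by
  rw [star_mul_self, h, coe_natCast]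

/-- Every rational quaternion is at distance less than one from the Hurwitz order. -/
lemma exists_normSq_sub_lt (z : ℍ[ℚ]) : ∃ q ∈ hurwitz, normSq (z - q) < 1 := by
  have near : ∀ t : ℚ, (t - round t) ^ 2 ≤ 1 / 4 := by
    intro t
    have h := abs_sub_round t
    rw [← sq_abs]
    nlinarith [abs_nonneg (t - round t)]
  let q : ℍ[ℚ] := ⟨round z.re, round z.imI, round z.imJ, round z.imK⟩
  have hq : q ∈ hurwitz := mem_hurwitz_iff.2
    ⟨round z.re - round z.imK, round z.imI - round z.imK, round z.imJ - round z.imK,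
      2 * round z.imK, by simp [q], by simp [q], by simp [q], by simp [q]⟩
  have hN : normSq (z - q) = (z.re - round z.re) ^ 2 + (z.imI - round z.imI) ^ 2
      + (z.imJ - round z.imJ) ^ 2 + (z.imK - round z.imK) ^ 2 := by
    rw [normSq_def', re_sub, imI_sub, imJ_sub, imK_sub]
  by_cases hlt : normSq (z - q) < 1
  · exact ⟨q, hq, hlt⟩
  -- Rounding fails only if all four squares equal `1/4`. Then every coordinate of `z` is a
  -- half-integer, and `z` itself lies in the order.
  have e : ∀ t : ℚ, (t - round t) ^ 2 = 1 / 4 → ∃ n : ℤ, t = n + 1 / 2 := by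
    intro t ht
    have : (t - round t - 1 / 2) * (t - round t + 1 / 2) = 0 := by linear_combination ht
    rcases mul_eq_zero.1 this with h | h
    · exact ⟨round t, by linarith⟩
    · exact ⟨round t - 1, by push_cast; linarith⟩
  have n1 := near z.re
  have n2 := near z.imI
  have n3 := near z.imJ
  have n4 := near z.imK
  obtain ⟨a, ha⟩ := e z.re (by linarith)
  obtain ⟨b, hb⟩ := e z.imI (by linarith)
  obtain ⟨c, hc⟩ := e z.imJ (by linarith)
  obtain ⟨d, hd⟩ := e z.imK (by linarith)
  refine ⟨z, mem_hurwitz_iff.2 ⟨a - d, b - d, c - d, 2 * d + 1, ?_, ?_, ?_, ?_⟩, by simp⟩ <;>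
    simp only [ha, hb, hc, hd] <;> push_cast <;> ring

/-- Right ideals of the Hurwitz order are principal. -/
theorem exists_generator (I : AddSubgroup ℍ[ℚ]) (hI : ∀ x ∈ I, x ∈ hurwitz)
    (hmul : ∀ x ∈ I, ∀ y ∈ hurwitz, x * y ∈ I) :
    ∃ d ∈ I, ∀ x ∈ I, ∃ y ∈ hurwitz, x = d * y := by
  classical
  by_cases h0 : ∀ x ∈ I, x = 0
  · exact ⟨0, I.zero_mem, fun x hx => ⟨0, hurwitz.zero_mem, by simp [h0 x hx]⟩⟩
  push Not at h0
  have hex : ∃ n : ℕ, ∃ x ∈ I, x ≠ 0 ∧ normSq x = n := by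
    obtain ⟨x, hx, hx0⟩ := h0
    obtain ⟨n, hn⟩ := exists_normSq_eq (hI x hx)
    exact ⟨n, x, hx, hx0, hn⟩
  obtain ⟨d, hd, hd0, hdn⟩ := Nat.find_spec hex
  refine ⟨d, hd, fun x hx => ?_⟩
  obtain ⟨q, hq, hlt⟩ := exists_normSq_sub_lt (d⁻¹ * x)
  refine ⟨q, hq, ?_⟩
  by_contra hne
  have hr : x - d * q ∈ I := I.sub_mem hx (hmul d hd q hq)
  obtain ⟨n, hn⟩ := exists_normSq_eq (hI _ hr)
  refine Nat.find_min hex (m := n) ?_ ⟨_, hr, sub_ne_zero.2 hne, hn⟩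
  have e : x - d * q = d * (d⁻¹ * x - q) := by
    rw [mul_sub, mul_inv_cancel_left₀ hd0]
  have hpos : 0 < normSq d := lt_of_le_of_ne normSq_nonneg (Ne.symm (by simpa using hd0))
  have : (n : ℚ) < (Nat.find hex : ℕ) := by
    rw [← hn, ← hdn, e, map_mul]
    nlinarith
  exact_mod_cast this

/-- An element of norm divisible by `p`, but not itself divisible by `p`, has a left factor of
norm `p`. -/
theorem exists_left_factor {p : ℕ} (hp : p.Prime) {x : ℍ[ℚ]} (hx : x ∈ hurwitz) {k : ℕ}
    (hk : normSq x = (p * k : ℕ)) (hnd : ∀ y ∈ hurwitz, x ≠ p * y) :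
    ∃ d ∈ hurwitz, normSq d = p ∧ (∃ y ∈ hurwitz, x = d * y) ∧
      ∃ a ∈ hurwitz, ∃ b ∈ hurwitz, d = x * a + p * b := by
  let I : AddSubgroup ℍ[ℚ] :=
    { carrier := {z | ∃ a ∈ hurwitz, ∃ b ∈ hurwitz, z = x * a + p * b}
      add_mem' := by
        rintro _ _ ⟨a, ha, b, hb, rfl⟩ ⟨a', ha', b', hb', rfl⟩
        exact ⟨a + a', add_mem ha ha', b + b', add_mem hb hb', by rw [mul_add, mul_add]; abel⟩
      zero_mem' := ⟨0, zero_mem _, 0, zero_mem _, by simp⟩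
      neg_mem' := by
        rintro _ ⟨a, ha, b, hb, rfl⟩
        exact ⟨-a, neg_mem ha, -b, neg_mem hb, by rw [mul_neg, mul_neg]; abel⟩ }
  obtain ⟨d, ⟨a, ha, b, hb, hdab⟩, hd⟩ := exists_generator I
    (by
      rintro _ ⟨a, ha, b, hb, rfl⟩
      exact add_mem (mul_mem hx ha) (mul_mem (natCast_mem _ p) hb))
    (by
      rintro _ ⟨a, ha, b, hb, rfl⟩ y hy
      exact ⟨a * y, mul_mem ha hy, b * y, mul_mem hb hy, by rw [add_mul, mul_assoc, mul_assoc]⟩)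
  obtain ⟨y, hy, hxy⟩ := hd x ⟨1, one_mem _, 0, zero_mem _, by simp⟩
  obtain ⟨z, hz, hpz⟩ := hd p ⟨0, zero_mem _, 1, one_mem _, by simp⟩
  have hdO : d ∈ hurwitz := by
    rw [hdab]
    exact add_mem (mul_mem hx ha) (mul_mem (natCast_mem _ p) hb)
  obtain ⟨n, hn⟩ := exists_normSq_eq hdO
  obtain ⟨m, hm⟩ := exists_normSq_eq hz
  have hnm : n * m = p ^ 2 := by
    have := congrArg normSq hpz
    rw [map_mul, hn, hm, normSq_natCast] at this
    exact_mod_cast this.symm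
  refine ⟨d, hdO, ?_, ⟨y, hy, hxy⟩, a, ha, b, hb, hdab⟩
  obtain ⟨i, hi, rfl⟩ := (Nat.dvd_prime_pow hp).1 ⟨m, hnm.symm⟩
  -- The norm of the generator `d` of `x 𝒪 + p 𝒪` divides `p ^ 2`. Norm `1` is impossible: `d - p b
  -- = x a` has norm divisible by `p`, yet congruent to `normSq d` modulo `p`. Norm `p ^ 2` makes
  -- `z` a unit, so `d` and `p` are associates and `p` divides `x`.
  interval_cases i
  · exfalso
    have e : normSq (d - (p : ℍ[ℚ]) * b) = normSq (x * a) := by rw [hdab, add_sub_cancel_right]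
    obtain ⟨t, ht⟩ := exists_trace_eq (mul_mem hdO (star_mem_hurwitz hb))
    obtain ⟨l, hl⟩ := exists_normSq_eq hb
    obtain ⟨j, hj⟩ := exists_normSq_eq ha
    have e2 : normSq (d - (p : ℍ[ℚ]) * b) = 1 - p * t + p ^ 2 * l := by
      have h1 : normSq d = 1 := by simpa using hn
      rw [← h1, ← ht, ← hl]
      simp only [normSq_def', re_sub, imI_sub, imJ_sub, imK_sub, re_mul, imI_mul, imJ_mul, imK_mul,
        re_star, imI_star, imJ_star, imK_star, re_natCast, imI_natCast, imJ_natCast, imK_natCast]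
      ring
    rw [e2, map_mul, hk, hj] at e
    have e3 : (1 : ℤ) = p * (t - p * l + k * j) := by
      have : (1 : ℚ) = p * (t - p * l + k * j) := by push_cast at e; linear_combination e
      exact_mod_cast this
    have : (p : ℤ) ∣ 1 := ⟨_, e3⟩
    exact hp.one_lt.ne' (by exact_mod_cast Int.eq_one_of_dvd_one (by positivity) this)
  · simpa using hn
  · exfalso
    have hm1 : normSq z = (1 : ℕ) := by
      rw [hm]
      have : p ^ 2 * m = p ^ 2 * 1 := by rw [hnm, mul_one]
      exact_mod_cast Nat.eq_of_mul_eq_mul_left (pow_pos hp.pos 2) this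
    refine hnd (star z * y) (mul_mem (star_mem_hurwitz hz) hy) ?_
    rw [hxy, hpz, ← mul_assoc, mul_assoc d z, mul_star_eq hm1]
    simp

/-- A product `a b c` with `b` of norm `p` is divisible by `p` only if `a b` or `b c` is. -/
theorem dvd_or_dvd_of_dvd_mul_mul {p : ℕ} (hp : p.Prime) {a b c : ℍ[ℚ]} (ha : a ∈ hurwitz)
    (hb : b ∈ hurwitz) (hc : c ∈ hurwitz) (hbp : normSq b = p)
    (h : ∃ y ∈ hurwitz, a * (b * c) = p * y) :
    (∃ y ∈ hurwitz, a * b = p * y) ∨ ∃ y ∈ hurwitz, b * c = p * y := by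
  by_cases hbc : ∃ y ∈ hurwitz, b * c = p * y
  · exact Or.inr hbc
  left
  push Not at hbc
  obtain ⟨k, hk⟩ := exists_normSq_eq hc
  obtain ⟨d, hd, hdp, -, r, hr, s, hs, hds⟩ := exists_left_factor hp (mul_mem hb hc) (k := k)
    (by rw [map_mul, hbp, hk]; push_cast; rfl) hbc
  obtain ⟨y, hy, hay⟩ := h
  have hf : c * r + star b * s ∈ hurwitz :=
    add_mem (mul_mem hc hr) (mul_mem (star_mem_hurwitz hb) hs)
  -- As `p = b * star b`, the generator `d` of `b c 𝒪 + p 𝒪` lies in `b 𝒪`; equal norms make the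
  -- cofactor a unit. So `b` lies in `b c 𝒪 + p 𝒪`, which left multiplication by `a` carries into `p
  -- 𝒪`.
  have hdf : d = b * (c * r + star b * s) := by
    rw [hds, ← mul_star_eq hbp]
    noncomm_ring
  generalize c * r + star b * s = f at hf hdf
  have hf1 : normSq f = (1 : ℕ) := by
    have := congrArg normSq hdf
    rw [map_mul, hdp, hbp] at this
    have hp0 : (p : ℚ) ≠ 0 := by exact_mod_cast hp.ne_zero
    simpa [hp0] using this
  refine ⟨(y * r + a * s) * star f,
    mul_mem (add_mem (mul_mem hy hr) (mul_mem ha hs)) (star_mem_hurwitz hf), ?_⟩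
  have e : b = d * star f := by rw [hdf, mul_assoc, mul_star_eq hf1]; simp
  rw [e, hds, ← mul_assoc, ← mul_assoc, mul_add, ← mul_assoc a (b * c) r, hay, ← mul_assoc a,
    ← natCast_mul_comm, mul_add]
  noncomm_ring

/-- A product of elements of norm `p` is divisible by `p` only if two adjacent ones multiply to
a multiple of `p`. -/
theorem not_dvd_prod {p : ℕ} (hp : p.Prime) (l : List ℍ[ℚ]) (hl : l ≠ [])
    (hmem : ∀ x ∈ l, x ∈ hurwitz ∧ normSq x = p)
    (hred : l.IsChain fun a b => ∀ y ∈ hurwitz, a * b ≠ p * y) :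
    ∀ y ∈ hurwitz, l.prod ≠ p * y := by
  induction l with
  | nil => exact absurd rfl hl
  | cons a l ih =>
    rintro y hy h
    cases l with
    | nil =>
      rw [List.prod_singleton] at h
      have hN := (hmem a (by simp)).2
      obtain ⟨n, hn⟩ := exists_normSq_eq hy
      rw [h, map_mul, hn, normSq_natCast] at hN
      have h1 : p * (p * n) = p * 1 := by
        have : (p * (p * n) : ℚ) = p := by linear_combination hN
        rw [mul_one]; exact_mod_cast this
      exact hp.one_lt.ne' (Nat.dvd_one.1 ⟨n, (Nat.eq_of_mul_eq_mul_left hp.pos h1).symm⟩)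
    | cons b l =>
      rw [List.isChain_cons_cons] at hred
      have hmem' : ∀ x ∈ b :: l, x ∈ hurwitz ∧ normSq x = p :=
        fun x hx => hmem x (List.mem_cons_of_mem _ hx)
      have hprod : l.prod ∈ hurwitz :=
        list_prod_mem fun x hx => (hmem' x (List.mem_cons_of_mem _ hx)).1
      have hb := hmem' b (by simp)
      rw [List.prod_cons, List.prod_cons] at h
      rcases dvd_or_dvd_of_dvd_mul_mul hp (hmem a (by simp)).1 hb.1 hprod hb.2 ⟨y, hy, h⟩ with
        ⟨z, hz, e⟩ | ⟨z, hz, e⟩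
      · exact hred.1 z hz e
      · exact ih (by simp) hmem' hred.2 z hz (by rw [List.prod_cons, e])

/-! ### The projective `S`-unit group -/

section Group

lemma normSq_algebraMap (c : ℚ) : normSq (algebraMap ℚ ℍ[ℚ] c) = c ^ 2 :=
  normSq_coe (R := ℚ) (x := c)

variable {S : Finset Nat.Primes}

@[simp] lemma quat_mul (g h : Gam S) : quat (g * h) = quat g * quat h := rfl

lemma quat_mul_quat_inv (g : Gam S) : quat g * quat g⁻¹ = 1 := congrArg Subtype.val g.mul_inv

lemma quat_ne_zero (g : Gam S) : quat g ≠ 0 := left_ne_zero_of_mul_eq_one (quat_mul_quat_inv g)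

lemma quat_inv (g : Gam S) : quat g⁻¹ = (quat g)⁻¹ := eq_inv_of_mul_eq_one_right (quat_mul_quat_inv g)

lemma quat_injective : Function.Injective (quat : Gam S → ℍ[ℚ]) :=
  fun _ _ h => Units.ext (Subtype.ext h)

lemma bar_eq_one_iff {g : Gam S} : bar g = 1 ↔ ∃ c : ℚ, quat g = algebraMap ℚ ℍ[ℚ] c :=
  QuotientGroup.eq_one_iff g

lemma bar_eq_iff {g h : Gam S} : bar g = bar h ↔ ∃ c : ℚ, quat h = quat g * algebraMap ℚ ℍ[ℚ] c := by
  have e : bar g = bar h ↔ bar (g⁻¹ * h) = 1 := by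
    rw [map_mul, map_inv, inv_mul_eq_one]
  rw [e, bar_eq_one_iff]
  simp only [quat_mul, quat_inv, inv_mul_eq_iff_eq_mul₀ (quat_ne_zero g)]

lemma mS_pos (S : Finset Nat.Primes) : 0 < mS S := Finset.prod_pos fun p _ => p.2.pos

lemma dvd_mS {p : Nat.Primes} (hp : p ∈ S) : (p : ℕ) ∣ mS S :=
  Finset.dvd_prod_of_mem (fun p : Nat.Primes => (p : ℕ)) hp

lemma exists_of_prime_dvd_mS_pow {q n : ℕ} (hq : q.Prime) (h : q ∣ mS S ^ n) :
    ∃ p : S, ((p : Nat.Primes) : ℕ) = q := by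
  obtain ⟨p, hp, hd⟩ := (hq.prime.dvd_finsetProd_iff _).1 (hq.dvd_of_dvd_pow h)
  exact ⟨⟨p, hp⟩, ((Nat.prime_dvd_prime_iff_eq hq p.2).1 hd).symm⟩

/-- An element of the Hurwitz order whose norm divides a power of `m_S` is an `S`-unit. -/
lemma exists_quat_eq {x : ℍ[ℚ]} (hx : x ∈ hurwitz) {n k : ℕ} (hn : normSq x = n)
    (hk : n ∣ mS S ^ k) : ∃ g : Gam S, quat g = x := by
  have hn0 : n ≠ 0 := fun h => by
    rw [h, zero_dvd_iff] at hk
    exact (pow_pos (mS_pos S) k).ne' hk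
  have hn0' : (n : ℚ) ≠ 0 := by exact_mod_cast hn0
  obtain ⟨l, hl⟩ := hk
  have hinv : ((n : ℚ)⁻¹ • star x) ∈ sOrder S := by
    refine ⟨k, ?_⟩
    have : mS S ^ k • ((n : ℚ)⁻¹ • star x) = l • star x := by
      rw [← Nat.cast_smul_eq_nsmul ℚ, ← Nat.cast_smul_eq_nsmul ℚ, smul_smul, hl]
      congr 1
      push_cast
      field_simp
    rw [this]
    exact nsmul_mem (star_mem_hurwitz hx) l
  refine ⟨⟨⟨x, hurwitz_le_sOrder S hx⟩, ⟨_, hinv⟩, Subtype.ext ?_, Subtype.ext ?_⟩, rfl⟩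
  · change x * ((n : ℚ)⁻¹ • star x) = 1
    rw [mul_smul_comm, mul_star_eq hn, ← coe_natCast, smul_coe, inv_mul_cancel₀ hn0', coe_one]
  · change ((n : ℚ)⁻¹ • star x) * x = 1
    rw [smul_mul_assoc, star_mul_eq hn, ← coe_natCast, smul_coe, inv_mul_cancel₀ hn0', coe_one]

lemma exists_mem_normSet {x : ℍ[ℚ]} (hx : x ∈ hurwitz) {p : Nat.Primes} (hp : p ∈ S)
    (hn : normSq x = (p : ℕ)) : ∃ g ∈ normSet S p, quat g = x := by
  obtain ⟨g, rfl⟩ := exists_quat_eq (S := S) hx hn (k := 1) (by simpa using dvd_mS hp)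
  exact ⟨g, ⟨hx, hn⟩, rfl⟩

lemma exists_unit {x : ℍ[ℚ]} (hx : x ∈ hurwitz) (hn : normSq x = 1) : ∃ g : Gam S, quat g = x :=
  exists_quat_eq hx (n := 1) (k := 0) (by simpa using hn) (by simp)

lemma normSq_unit (u : hurwitzˣ) : normSq (u.1 : ℍ[ℚ]) = 1 := by
  obtain ⟨n, hn⟩ := exists_normSq_eq u.1.2
  obtain ⟨m, hm⟩ := exists_normSq_eq (u⁻¹).1.2
  have h : (u.1 : ℍ[ℚ]) * (u⁻¹).1 = 1 := congrArg Subtype.val u.mul_inv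
  have h2 := congrArg normSq h
  rw [map_mul, hn, hm, map_one] at h2
  have h3 : n * m = 1 := by exact_mod_cast h2
  rw [hn, Nat.eq_one_of_mul_eq_one_right h3, Nat.cast_one]

lemma mem_unitsBar_iff {x : GamBar S} :
    x ∈ unitsBar S ↔ ∃ g : Gam S, quat g ∈ hurwitz ∧ normSq (quat g) = 1 ∧ bar g = x := by
  constructor
  · rintro ⟨u, rfl⟩
    refine ⟨Units.map (Subring.inclusion (hurwitz_le_sOrder S)).toMonoidHom u, u.1.2,
      normSq_unit u, rfl⟩
  · rintro ⟨g, hg, hn, rfl⟩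
    have hn' : normSq (quat g) = (1 : ℕ) := by simpa using hn
    refine ⟨⟨⟨quat g, hg⟩, ⟨star (quat g), star_mem_hurwitz hg⟩, Subtype.ext ?_, Subtype.ext ?_⟩, ?_⟩
    · exact (mul_star_eq hn').trans Nat.cast_one
    · exact (star_mul_eq hn').trans Nat.cast_one
    · exact congrArg bar (quat_injective rfl)

lemma bar_mem_unitsBar_iff {g : Gam S} : bar g ∈ unitsBar S ↔
    ∃ c : ℚ, ∃ u ∈ hurwitz, normSq u = 1 ∧ quat g = u * algebraMap ℚ ℍ[ℚ] c := by
  rw [mem_unitsBar_iff]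
  constructor
  · rintro ⟨h, hO, hN, e⟩
    obtain ⟨c, hc⟩ := bar_eq_iff.1 e
    exact ⟨c, quat h, hO, hN, hc⟩
  · rintro ⟨c, u, hu, hN, e⟩
    obtain ⟨h, rfl⟩ := exists_unit (S := S) hu hN
    exact ⟨h, hu, hN, bar_eq_iff.2 ⟨c, e⟩⟩

lemma mul_mem_normSet {p : ℕ} {g u : Gam S} (hg : g ∈ normSet S p) (hu : quat u ∈ hurwitz)
    (hN : normSq (quat u) = 1) : g * u ∈ normSet S p :=
  ⟨mul_mem hg.1 hu, by rw [quat_mul, map_mul, hg.2, hN, mul_one]⟩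

lemma mul_mem_normSet' {p : ℕ} {g u : Gam S} (hg : g ∈ normSet S p) (hu : quat u ∈ hurwitz)
    (hN : normSq (quat u) = 1) : u * g ∈ normSet S p :=
  ⟨mul_mem hu hg.1, by rw [quat_mul, map_mul, hg.2, hN, one_mul]⟩

/-- The image in `Γ̄_S` of the elements of norm `p` of the Hurwitz order. -/
def normBar (S : Finset Nat.Primes) (p : ℕ) : Set (GamBar S) := bar '' normSet S p

lemma mul_unit_mem_normBar {p : ℕ} {x u : GamBar S} (hx : x ∈ normBar S p) (hu : u ∈ unitsBar S) :
    x * u ∈ normBar S p := by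
  obtain ⟨g, hg, rfl⟩ := hx
  obtain ⟨h, hO, hN, rfl⟩ := mem_unitsBar_iff.1 hu
  exact ⟨g * h, mul_mem_normSet hg hO hN, map_mul _ _ _⟩

lemma unit_mul_mem_normBar {p : ℕ} {x u : GamBar S} (hx : x ∈ normBar S p) (hu : u ∈ unitsBar S) :
    u * x ∈ normBar S p := by
  obtain ⟨g, hg, rfl⟩ := hx
  obtain ⟨h, hO, hN, rfl⟩ := mem_unitsBar_iff.1 hu
  exact ⟨h * g, mul_mem_normSet' hg hO hN, map_mul _ _ _⟩

/-- Modulo scalars the inverse is the conjugate, because `x * star x = p`. -/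
lemma inv_mem_normBar {p : Nat.Primes} (hp : p ∈ S) {x : GamBar S} (hx : x ∈ normBar S p) :
    x⁻¹ ∈ normBar S p := by
  obtain ⟨g, hg, rfl⟩ := hx
  obtain ⟨h, hh, e⟩ := exists_mem_normSet (star_mem_hurwitz hg.1) hp ((normSq_star _).trans hg.2)
  refine ⟨h, hh, ?_⟩
  rw [← map_inv, eq_comm, bar_eq_iff]
  refine ⟨(p : ℕ), ?_⟩
  rw [e, quat_inv, eq_inv_mul_iff_mul_eq₀ (quat_ne_zero g), mul_star_eq hg.2, map_natCast]

/-- A scalar of norm `p` would make `p` a rational square, against the parity of the `p`-adic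
valuation. -/
lemma one_notMem_normBar (p : Nat.Primes) : (1 : GamBar S) ∉ normBar S p := by
  rintro ⟨g, hg, e⟩
  obtain ⟨c, hc⟩ := bar_eq_one_iff.1 e
  have h := hg.2
  rw [hc, normSq_algebraMap] at h
  have h1 : padicValRat p (c ^ 2) = 1 := by
    rw [h]; simp
  have hc0 : c ≠ 0 := by
    rintro rfl
    exact p.2.ne_zero (by exact_mod_cast (by simpa using h.symm : ((p : ℕ) : ℚ) = 0))
  rw [padicValRat.pow] at h1
  push_cast at h1
  omega

/-- Elements of coprime prime norms can be exchanged. -/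
lemma exists_exchange {p q : Nat.Primes} (hp : p ∈ S) (hq : q ∈ S) (hpq : p ≠ q) {x y : GamBar S}
    (hx : x ∈ normBar S p) (hy : y ∈ normBar S q) :
    ∃ y' ∈ normBar S q, ∃ x' ∈ normBar S p, x * y = y' * x' := by
  obtain ⟨g, hg, rfl⟩ := hx
  obtain ⟨h, hh, rfl⟩ := hy
  have hne : (p : ℕ) ≠ q := fun e => hpq (Subtype.ext e)
  -- The product has norm `p q`, which `q ^ 2` does not divide, so it is not a multiple of `q` and
  -- has a left factor of norm `q`.
  obtain ⟨d, hd, hdq, ⟨z, hz, e⟩, -⟩ := exists_left_factor q.2 (mul_mem hg.1 hh.1) (k := p)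
    (by rw [map_mul, hg.2, hh.2]; push_cast; ring) (by
      intro y hy e
      obtain ⟨n, hn⟩ := exists_normSq_eq hy
      have e2 := congrArg normSq e
      rw [map_mul, map_mul, hg.2, hh.2, normSq_natCast, hn] at e2
      have e3 : (q * p : ℕ) = q * (q * n) := by
        have : ((q : ℕ) * (p : ℕ) : ℚ) = (q : ℕ) * ((q : ℕ) * n) := by linear_combination e2
        exact_mod_cast this
      exact hne ((Nat.prime_dvd_prime_iff_eq q.2 p.2).1
        ⟨n, Nat.eq_of_mul_eq_mul_left q.2.pos e3⟩).symm)
  have hzp : normSq z = (p : ℕ) := by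
    have e2 := congrArg normSq e
    rw [map_mul, map_mul, hg.2, hh.2, hdq] at e2
    have hq0 : ((q : ℕ) : ℚ) ≠ 0 := by exact_mod_cast q.2.ne_zero
    exact mul_left_cancel₀ hq0 (by linear_combination -e2)
  obtain ⟨y', hy', rfl⟩ := exists_mem_normSet hd hq hdq
  obtain ⟨x', hx', rfl⟩ := exists_mem_normSet hz hp hzp
  refine ⟨_, ⟨y', hy', rfl⟩, _, ⟨x', hx', rfl⟩, ?_⟩
  rw [← map_mul, ← map_mul, quat_injective (S := S) (a₁ := g * h) (a₂ := y' * x') e]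

/-! ### Generation by units and elements of prime norm -/

/-- Induction on the norm, whose prime factors all lie in `S`. For such a factor `p`, either `p`
divides the element and disappears modulo scalars, or a left factor of norm `p` splits off; both
lower the norm. -/
lemma bar_mem_closure {n : ℕ} : ∀ {x : ℍ[ℚ]} (_ : x ∈ hurwitz) (_ : normSq x = n) {k : ℕ}
    (_ : n ∣ mS S ^ k) {g : Gam S} (_ : quat g = x) ,
    bar g ∈ Subgroup.closure ((unitsBar S : Set (GamBar S)) ∪
      ⋃ p : S, normBar S (p : Nat.Primes)) := by
  induction n using Nat.strong_induction_on with
  | _ n ih =>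
  intro x hx hn k hk g hg
  have hn0 : n ≠ 0 := fun h => by
    rw [h, zero_dvd_iff] at hk
    exact (pow_pos (mS_pos S) k).ne' hk
  by_cases h1 : n = 1
  · refine Subgroup.subset_closure (Or.inl (mem_unitsBar_iff.2 ⟨g, hg ▸ hx, ?_, rfl⟩))
    rw [hg, hn, h1, Nat.cast_one]
  obtain ⟨q, hq, m, rfl⟩ := Nat.exists_prime_and_dvd h1
  obtain ⟨p, rfl⟩ := exists_of_prime_dvd_mS_pow (S := S) hq ((dvd_mul_right q m).trans hk)
  have hq0 : (((p : Nat.Primes) : ℕ) : ℚ) ≠ 0 := by exact_mod_cast hq.ne_zero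
  have hm0 : 0 < m := Nat.pos_of_ne_zero (right_ne_zero_of_mul hn0)
  by_cases hd : ∃ y ∈ hurwitz, x = ((p : Nat.Primes) : ℕ) * y
  · obtain ⟨y, hy, rfl⟩ := hd
    obtain ⟨l, hl⟩ := exists_normSq_eq hy
    have hml : m = (p : Nat.Primes) * l := by
      rw [map_mul, normSq_natCast, hl] at hn
      have : (m : ℚ) = (p : Nat.Primes) * l :=
        mul_left_cancel₀ hq0 (by push_cast at hn; linear_combination -hn)
      exact_mod_cast this
    have hlk : l ∣ mS S ^ k := by
      refine Dvd.dvd.trans ?_ hk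
      rw [hml]
      exact ⟨((p : Nat.Primes) : ℕ) ^ 2, by ring⟩
    obtain ⟨h, hh⟩ := exists_quat_eq hy hl hlk
    have hlt : l < (p : Nat.Primes) * m := by
      have := hq.two_le
      have : 0 < l := Nat.pos_of_ne_zero (by rintro rfl; simp [hml] at hm0)
      rw [hml]
      nlinarith [Nat.mul_le_mul hq.two_le hq.two_le]
    have e : bar g = bar h := by
      rw [eq_comm, bar_eq_iff]
      exact ⟨((p : Nat.Primes) : ℕ), by rw [hg, hh, map_natCast, natCast_mul_comm]⟩
    rw [e]
    exact ih l hlt hy hl hlk hh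
  · push Not at hd
    obtain ⟨d, hdO, hdp, ⟨y, hy, rfl⟩, -⟩ := exists_left_factor hq hx hn hd
    have hym : normSq y = m := by
      rw [map_mul, hdp] at hn
      exact mul_left_cancel₀ hq0 (by push_cast at hn; linear_combination hn)
    have hmk : m ∣ mS S ^ k := (dvd_mul_left _ _).trans hk
    obtain ⟨h, hh⟩ := exists_quat_eq hy hym hmk
    obtain ⟨f, hf, hfd⟩ := exists_mem_normSet hdO p.2 hdp
    have e : g = f * h := quat_injective (by rw [hg, quat_mul, hfd, hh])
    rw [e, map_mul]
    refine Subgroup.mul_mem _ (Subgroup.subset_closure (Or.inr (Set.mem_iUnion.2 ⟨p, f, hf, rfl⟩)))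
      (ih m ?_ hy hym hmk hh)
    nlinarith [hq.two_le]

/-- `Γ̄_S` is generated by the units of the Hurwitz order and the elements of norm `p ∈ S`. -/
theorem closure_eq_top : Subgroup.closure ((unitsBar S : Set (GamBar S)) ∪
    ⋃ p : S, normBar S (p : Nat.Primes)) = ⊤ := by
  refine eq_top_iff.2 fun x _ => ?_
  obtain ⟨g, rfl⟩ := QuotientGroup.mk'_surjective _ x
  obtain ⟨n, hn⟩ : quat g ∈ sOrder S := (g : sOrder S).2
  obtain ⟨n', hn'⟩ : quat g⁻¹ ∈ sOrder S := ((g⁻¹ : Gam S) : sOrder S).2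
  obtain ⟨a, ha⟩ := exists_normSq_eq hn
  obtain ⟨b, hb⟩ := exists_normSq_eq hn'
  -- After denominators are cleared, the norms of an element and of its inverse multiply to a power
  -- of `mS S`; so the cleared norm involves only primes of `S`.
  have hab : a * b = mS S ^ (2 * n + 2 * n') := by
    have h := congrArg normSq (quat_mul_quat_inv g)
    rw [map_mul, map_one] at h
    rw [nsmul_eq_mul, map_mul, normSq_natCast] at ha hb
    have : (a * b : ℚ) = (mS S : ℚ) ^ (2 * n + 2 * n') := by
      rw [← ha, ← hb]
      push_cast
      linear_combination (mS S : ℚ) ^ (2 * n + 2 * n') * h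
    exact_mod_cast this
  obtain ⟨h, hh⟩ := exists_quat_eq hn ha ⟨b, hab.symm⟩
  have e : bar g = bar h := bar_eq_iff.2 ⟨(mS S ^ n : ℕ), by
    rw [hh, nsmul_eq_mul, natCast_mul_comm, map_natCast]⟩
  change bar g ∈ _
  rw [e]
  exact bar_mem_closure hn ha ⟨b, hab.symm⟩ hh

/-! ### Sorted words without cancellation -/

/-- Right multiplication by `star x` shows that `p` divides `n y`, and a Bézout relation between `n`
and `p` removes `n`. -/
lemma dvd_of_mul_left_dvd {p n : ℕ} (hn : n.Coprime p) {x y : ℍ[ℚ]} (hx : normSq x = n)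
    (hxO : x ∈ hurwitz) (hy : y ∈ hurwitz) (h : ∃ z ∈ hurwitz, y * x = p * z) :
    ∃ z ∈ hurwitz, y = p * z := by
  obtain ⟨z, hz, e⟩ := h
  have h1 : (n : ℍ[ℚ]) * y = p * (z * star x) := by
    rw [← mul_assoc, ← e, mul_assoc, mul_star_eq hx, natCast_mul_comm]
  have hbez : (n : ℤ) * n.gcdA p + p * n.gcdB p = 1 := by
    rw [← Nat.gcd_eq_gcd_ab, hn]; rfl
  have hbez' : (1 : ℍ[ℚ]) = n.gcdA p * n + p * n.gcdB p := by
    rw [(Int.cast_commute (n.gcdA p) (n : ℍ[ℚ])).eq]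
    exact_mod_cast congrArg (Int.cast : ℤ → ℍ[ℚ]) hbez.symm
  refine ⟨n.gcdA p * (z * star x) + n.gcdB p * y,
    add_mem (mul_mem (intCast_mem _ _) (mul_mem hz (star_mem_hurwitz hxO)))
      (mul_mem (intCast_mem _ _) hy), ?_⟩
  calc y = (n.gcdA p * n + p * n.gcdB p) * y := by rw [← hbez', one_mul]
    _ = n.gcdA p * (n * y) + p * (n.gcdB p * y) := by rw [add_mul, mul_assoc, mul_assoc]
    _ = _ := by
      rw [h1, ← mul_assoc, ((Int.cast_commute (n.gcdA p) (p : ℍ[ℚ])).eq), mul_assoc, ← mul_add]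

lemma exists_int_eq {c : ℚ} (h : algebraMap ℚ ℍ[ℚ] c ∈ hurwitz) : ∃ a : ℤ, c = a := by
  obtain ⟨a, b, e, d, h1, -, -, h4⟩ := mem_hurwitz_iff.1 h
  have h5 : (0 : ℚ) = d / 2 := h4
  have h6 : c = a + d / 2 := h1
  exact ⟨a, by rw [h6, ← h5, add_zero]⟩

lemma exists_append_of_pairwise {α : Type*} (k : α → ℕ) (m : ℕ) (L : List α)
    (hs : L.Pairwise fun a b => k a ≤ k b) (hm : ∀ a ∈ L, m ≤ k a) :
    ∃ A B, L = A ++ B ∧ (∀ a ∈ A, k a = m) ∧ ∀ b ∈ B, k b ≠ m := by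
  induction L with
  | nil => exact ⟨[], [], by simp⟩
  | cons a L ih =>
    rw [List.pairwise_cons] at hs
    by_cases h : k a = m
    · obtain ⟨A, B, rfl, hA, hB⟩ := ih hs.2 fun b hb => hm b (List.mem_cons_of_mem _ hb)
      exact ⟨a :: A, B, rfl, by simpa [h] using hA, hB⟩
    · refine ⟨[], a :: L, rfl, by simp, fun b hb => ?_⟩
      have h1 := hm a (by simp)
      rcases List.mem_cons.1 hb with rfl | hb
      · exact h
      · have := hs.1 b hb
        omega

lemma mul_mem_unitsBar_of_dvd {p : ℕ} (hp : p ≠ 0) {g h : Gam S} (hg : g ∈ normSet S p)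
    (hh : h ∈ normSet S p) {y : ℍ[ℚ]} (hy : y ∈ hurwitz) (e : quat g * quat h = p * y) :
    bar g * bar h ∈ unitsBar S := by
  have hp0 : (p : ℚ) ≠ 0 := by exact_mod_cast hp
  rw [← map_mul, bar_mem_unitsBar_iff]
  refine ⟨p, y, hy, ?_, ?_⟩
  · have e2 := congrArg normSq e
    rw [map_mul, map_mul, hg.2, hh.2, normSq_natCast] at e2
    exact mul_left_cancel₀ (pow_ne_zero 2 hp0) (by linear_combination -e2)
  · rw [quat_mul, e, map_natCast, natCast_mul_comm]

lemma exists_normSq_prod_eq (L : List (S × Gam S))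
    (hL : ∀ e ∈ L, e.2 ∈ normSet S (e.1 : Nat.Primes)) :
    (L.map fun e => quat e.2).prod ∈ hurwitz ∧
      normSq (L.map fun e => quat e.2).prod
        = ((L.map fun e => ((e.1 : Nat.Primes) : ℕ)).prod : ℕ) := by
  induction L with
  | nil => simp
  | cons e L ih =>
    have h := ih fun b hb => hL b (List.mem_cons_of_mem _ hb)
    have he := hL e (by simp)
    refine ⟨?_, ?_⟩
    · simpa using mul_mem he.1 h.1
    · rw [List.map_cons, List.prod_cons, map_mul, he.2, h.2, List.map_cons, List.prod_cons]
      push_cast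
      rfl

/-- Let `p` be the least prime of a nonempty word. If the product is a Hurwitz unit times a rational
`c`, then `c` is an integer, and `c ^ 2` is the product of the primes in the word, so `p` divides
`c` and hence the product. The factors at larger primes have norm prime to `p` and can be dropped,
so `p` divides the initial block of norm `p` elements, contrary to `not_dvd_prod`. -/
lemma lift_word_eq_nil (L : List (S × Gam S))
    (hL : ∀ e ∈ L, e.2 ∈ normSet S (e.1 : Nat.Primes))
    (hs : L.Pairwise fun a b => ((a.1 : Nat.Primes) : ℕ) ≤ (b.1 : Nat.Primes))
    (hc : L.IsChain fun a b => a.1 = b.1 → bar a.2 * bar b.2 ∉ unitsBar S)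
    (h : bar (L.map Prod.snd).prod ∈ unitsBar S) : L = [] := by
  cases L with
  | nil => rfl
  | cons e₀ L₀ =>
  exfalso
  set p : ℕ := ((e₀.1 : Nat.Primes) : ℕ) with hpdef
  have hp : p.Prime := (e₀.1 : Nat.Primes).2
  have hmin : ∀ a ∈ e₀ :: L₀, p ≤ ((a.1 : Nat.Primes) : ℕ) := by
    intro a ha
    rcases List.mem_cons.1 ha with rfl | ha
    · exact le_rfl
    · exact (List.pairwise_cons.1 hs).1 a ha
  obtain ⟨A, B, hAB, hA, hB⟩ := exists_append_of_pairwise _ p _ hs hmin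
  have hA0 : A ≠ [] := by
    rintro rfl
    exact hB e₀ (by rw [List.nil_append] at hAB; rw [← hAB]; simp) rfl
  have hquat : ∀ M : List (S × Gam S),
      quat (M.map Prod.snd).prod = (M.map fun e => quat e.2).prod := by
    intro M
    induction M with
    | nil => rfl
    | cons a M ih => rw [List.map_cons, List.prod_cons, quat_mul, ih, List.map_cons, List.prod_cons]
  obtain ⟨c, u, hu, hu1, huc⟩ := bar_mem_unitsBar_iff.1 h
  obtain ⟨hXO, hXN⟩ := exists_normSq_prod_eq _ hL
  rw [hquat] at huc
  have hu1' : normSq u = (1 : ℕ) := by simpa using hu1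
  have hcO : algebraMap ℚ ℍ[ℚ] c ∈ hurwitz := by
    have : star u * (u * algebraMap ℚ ℍ[ℚ] c) = algebraMap ℚ ℍ[ℚ] c := by
      rw [← mul_assoc, star_mul_eq hu1', Nat.cast_one, one_mul]
    rw [← this, ← huc]
    exact mul_mem (star_mem_hurwitz hu) hXO
  obtain ⟨a, rfl⟩ := exists_int_eq hcO
  have ha2 : a ^ 2 = (((e₀ :: L₀).map fun e => ((e.1 : Nat.Primes) : ℕ)).prod : ℕ) := by
    rw [huc, map_mul, hu1, normSq_algebraMap, one_mul] at hXN
    generalize ((e₀ :: L₀).map fun e => ((e.1 : Nat.Primes) : ℕ)).prod = N at hXN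
    exact_mod_cast hXN
  have hpa : (p : ℤ) ∣ a := by
    refine (Nat.prime_iff_prime_int.1 hp).dvd_of_dvd_pow (n := 2) ?_
    rw [ha2, List.map_cons, List.prod_cons]
    exact_mod_cast dvd_mul_right _ _
  obtain ⟨b, rfl⟩ := hpa
  have hX : ∃ z ∈ hurwitz, (A.map fun e => quat e.2).prod * (B.map fun e => quat e.2).prod
      = p * z := by
    refine ⟨u * b, mul_mem hu (intCast_mem _ _), ?_⟩
    rw [← List.prod_append, ← List.map_append, ← hAB, huc, map_intCast, Int.cast_mul,
      Int.cast_natCast, ← mul_assoc, ← mul_assoc, natCast_mul_comm]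
  have hLA : ∀ e ∈ A, e.2 ∈ normSet S (e.1 : Nat.Primes) :=
    fun e he => hL e (by rw [hAB]; exact List.mem_append_left _ he)
  have hLB : ∀ e ∈ B, e.2 ∈ normSet S (e.1 : Nat.Primes) :=
    fun e he => hL e (by rw [hAB]; exact List.mem_append_right _ he)
  have hcop : (B.map fun e => ((e.1 : Nat.Primes) : ℕ)).prod.Coprime p := by
    refine Nat.coprime_list_prod_left_iff.2 fun n hn => ?_
    obtain ⟨e, he, rfl⟩ := List.mem_map.1 hn
    exact (Nat.coprime_primes (e.1 : Nat.Primes).2 hp).2 (hB e he)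
  obtain ⟨z, hz, hAz⟩ := dvd_of_mul_left_dvd hcop (exists_normSq_prod_eq B hLB).2
    (exists_normSq_prod_eq B hLB).1 (exists_normSq_prod_eq A hLA).1 hX
  have hAp : ∀ e ∈ A, e.2 ∈ normSet S p := fun e he => hA e he ▸ hLA e he
  refine not_dvd_prod hp (A.map fun e => quat e.2) (by simpa using hA0) ?_ ?_ z hz hAz
  · intro x hx
    obtain ⟨e, he, rfl⟩ := List.mem_map.1 hx
    exact hAp e he
  · rw [hAB] at hc
    rw [List.isChain_map]
    refine (hc.left_of_append).imp_of_mem_imp ?_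
    intro e f he hf hef y hy hy'
    refine hef (Subtype.ext (Subtype.ext ((hA e he).trans (hA f hf).symm))) ?_
    exact mul_mem_unitsBar_of_dvd hp.ne_zero (hAp e he) (hAp f hf) hy hy'

/-- A sorted word without cancellations in elements of prime norms is not a unit. -/
theorem word_eq_nil (L : List (S × GamBar S))
    (hL : ∀ e ∈ L, e.2 ∈ normBar S (e.1 : Nat.Primes))
    (hs : L.Pairwise fun a b => ((a.1 : Nat.Primes) : ℕ) ≤ (b.1 : Nat.Primes))
    (hc : L.IsChain fun a b => a.1 = b.1 → a.2 * b.2 ∉ unitsBar S)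
    (h : (L.map Prod.snd).prod ∈ unitsBar S) : L = [] := by
  -- Elements of `normBar` get a lift of the right norm; the arbitrary lift elsewhere only makes the
  -- choice total.
  have hrep : ∀ e : S × GamBar S, ∃ g : Gam S,
      bar g = e.2 ∧ (e.2 ∈ normBar S (e.1 : Nat.Primes) → g ∈ normSet S (e.1 : Nat.Primes)) := by
    intro e
    by_cases he : e.2 ∈ normBar S (e.1 : Nat.Primes)
    · obtain ⟨g, hg, hb⟩ := he
      exact ⟨g, hb, fun _ => hg⟩
    · obtain ⟨g, hg⟩ := QuotientGroup.mk'_surjective (scalars S) e.2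
      exact ⟨g, hg, fun h => absurd h he⟩
  choose rep hbar hrep using hrep
  have := lift_word_eq_nil (L.map fun e => (e.1, rep e)) (by
      intro e he
      obtain ⟨f, hf, rfl⟩ := List.mem_map.1 he
      exact hrep f (hL f hf)) (by simpa [List.pairwise_map] using hs) (by
      rw [List.isChain_map]
      simpa [hbar] using hc) (by
      rw [map_list_prod, List.map_map, List.map_map]
      have : ((bar ∘ Prod.snd) ∘ fun e : S × GamBar S => (e.1, rep e)) = Prod.snd :=
        funext fun e => hbar e
      rwa [this])
  simpa using this

end Group

/-! ### A normal form criterion for injectivity -/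

section NormalForm

variable {E G ι : Type*} [Group E] [Group G] {H : Subgroup E} {Y : ι → Set E} {key : ι → ℕ}

/-- An element of `H` in front of a word is absorbed by its first letter, since `H Y i ⊆ Y i`; only
a final element of `H` can remain. -/
lemma exists_word (hHY : ∀ i, ∀ h ∈ H, ∀ y ∈ Y i, h * y ∈ Y i) (hinv : ∀ i, ∀ y ∈ Y i, y⁻¹ ∈ Y i)
    (hgen : Subgroup.closure ((H : Set E) ∪ ⋃ i, Y i) = ⊤) (g : E) :
    ∃ L : List (ι × E), (∀ e ∈ L, e.2 ∈ Y e.1) ∧ ∃ h ∈ H, g = (L.map Prod.snd).prod * h := by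
  have step : ∀ x y : E, x ∈ ((H : Set E) ∪ ⋃ i, Y i) →
      (∃ L : List (ι × E), (∀ e ∈ L, e.2 ∈ Y e.1) ∧ ∃ h ∈ H, y = (L.map Prod.snd).prod * h) →
      ∃ L : List (ι × E), (∀ e ∈ L, e.2 ∈ Y e.1) ∧ ∃ h ∈ H, x * y = (L.map Prod.snd).prod * h := by
    rintro x y hx ⟨L, hL, h, hh, rfl⟩
    rcases hx with hx | hx
    · cases L with
      | nil => exact ⟨[], by simp, x * h, mul_mem hx hh, by simp⟩
      | cons e L =>
        refine ⟨(e.1, x * e.2) :: L, ?_, h, hh, by simp [mul_assoc]⟩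
        intro f hf
        rcases List.mem_cons.1 hf with rfl | hf
        · exact hHY _ x hx _ (hL e (by simp))
        · exact hL f (by simp [hf])
    · obtain ⟨i, hi⟩ := Set.mem_iUnion.1 hx
      refine ⟨(i, x) :: L, ?_, h, hh, by simp [mul_assoc]⟩
      intro f hf
      rcases List.mem_cons.1 hf with rfl | hf
      · exact hi
      · exact hL f hf
  have hg : g ∈ Subgroup.closure ((H : Set E) ∪ ⋃ i, Y i) := hgen ▸ Subgroup.mem_top g
  induction hg using Subgroup.closure_induction_left with
  | one => exact ⟨[], by simp, 1, one_mem _, by simp⟩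
  | mul_left x hx y _ ih => exact step x y hx ih
  | inv_mul_cancel x hx y _ ih =>
    refine step x⁻¹ y ?_ ih
    rcases hx with hx | hx
    · exact Or.inl (H.inv_mem hx)
    · obtain ⟨i, hi⟩ := Set.mem_iUnion.1 hx
      exact Or.inr (Set.mem_iUnion.2 ⟨i, hinv i x hi⟩)

/-- Insertion sort, in which each exchange changes the group elements but not the indices. The
permutation clause records this, and it is what shows that the word stays sorted when its head is
put back. -/
lemma exists_insert_sorted
    (hex : ∀ i j, key j < key i → ∀ y ∈ Y i, ∀ y' ∈ Y j, ∃ z ∈ Y j, ∃ z' ∈ Y i, y * y' = z * z')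
    (L : List (ι × E)) (hL : ∀ e ∈ L, e.2 ∈ Y e.1)
    (hs : L.Pairwise fun a b => key a.1 ≤ key b.1) {i : ι} {y : E} (hy : y ∈ Y i) :
    ∃ M : List (ι × E), (∀ e ∈ M, e.2 ∈ Y e.1) ∧ (M.Pairwise fun a b => key a.1 ≤ key b.1) ∧
      (M.map Prod.fst).Perm (i :: L.map Prod.fst) ∧
      (M.map Prod.snd).prod = y * (L.map Prod.snd).prod := by
  induction L generalizing i y with
  | nil => exact ⟨[(i, y)], by simpa using hy, by simp, by simp, by simp⟩
  | cons e L ih =>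
    have he := hL e (by simp)
    have hL' : ∀ f ∈ L, f.2 ∈ Y f.1 := fun f hf => hL f (by simp [hf])
    have hs' := List.pairwise_cons.1 hs
    rcases le_or_gt (key i) (key e.1) with h | h
    · refine ⟨(i, y) :: e :: L, ?_, ?_, by simp, by simp⟩
      · intro f hf
        rcases List.mem_cons.1 hf with rfl | hf
        · exact hy
        · exact hL f hf
      · refine List.pairwise_cons.2 ⟨fun f hf => ?_, hs⟩
        rcases List.mem_cons.1 hf with rfl | hf
        · exact h
        · exact h.trans (hs'.1 f hf)
    · obtain ⟨z, hz, z', hz', e'⟩ := hex i e.1 h y hy e.2 he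
      obtain ⟨M, hM, hMs, hMp, hMe⟩ := ih hL' hs'.2 hz'
      refine ⟨(e.1, z) :: M, ?_, ?_, ?_, ?_⟩
      · intro f hf
        rcases List.mem_cons.1 hf with rfl | hf
        · exact hz
        · exact hM f hf
      · refine List.pairwise_cons.2 ⟨fun f hf => ?_, hMs⟩
        have : f.1 ∈ i :: L.map Prod.fst := hMp.subset (List.mem_map_of_mem hf)
        rcases List.mem_cons.1 this with h1 | h1
        · rw [h1]; exact h.le
        · obtain ⟨f', hf', e2⟩ := List.mem_map.1 h1
          rw [← e2]
          exact hs'.1 f' hf'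
      · simp only [List.map_cons]
        exact (hMp.cons e.1).trans (List.Perm.swap i e.1 _)
      · simp only [List.map_cons, List.prod_cons]
        rw [hMe, ← mul_assoc, ← e', mul_assoc]

lemma exists_sorted
    (hex : ∀ i j, key j < key i → ∀ y ∈ Y i, ∀ y' ∈ Y j, ∃ z ∈ Y j, ∃ z' ∈ Y i, y * y' = z * z')
    (L : List (ι × E)) (hL : ∀ e ∈ L, e.2 ∈ Y e.1) :
    ∃ M : List (ι × E), (∀ e ∈ M, e.2 ∈ Y e.1) ∧ (M.Pairwise fun a b => key a.1 ≤ key b.1) ∧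
      M.length = L.length ∧ (M.map Prod.snd).prod = (L.map Prod.snd).prod := by
  induction L with
  | nil => exact ⟨[], by simp, by simp, rfl, rfl⟩
  | cons e L ih =>
    obtain ⟨M, hM, hMs, hMl, hMe⟩ := ih fun f hf => hL f (by simp [hf])
    obtain ⟨N, hN, hNs, hNp, hNe⟩ := exists_insert_sorted hex M hM hMs (hL e (by simp))
    refine ⟨N, hN, hNs, ?_, ?_⟩
    · simpa [hMl] using hNp.length_eq
    · rw [hNe, hMe, List.map_cons, List.prod_cons]

/-- A homomorphism is injective if every element is a word in `Y` followed by an element of `H`,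
words can be sorted, cancellations can be lifted, and sorted words without cancellations are
not in the image of `H`. -/
theorem injective_of_words (π : E →* G)
    (hinj : ∀ h ∈ H, π h = 1 → h = 1)
    (hHY : ∀ i, ∀ h ∈ H, ∀ y ∈ Y i, h * y ∈ Y i) (hinv : ∀ i, ∀ y ∈ Y i, y⁻¹ ∈ Y i)
    (hcancel : ∀ i, ∀ y ∈ Y i, ∀ y' ∈ Y i, π y * π y' ∈ H.map π → y * y' ∈ H)
    (hex : ∀ i j, key j < key i → ∀ y ∈ Y i, ∀ y' ∈ Y j, ∃ z ∈ Y j, ∃ z' ∈ Y i, y * y' = z * z')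
    (hgen : Subgroup.closure ((H : Set E) ∪ ⋃ i, Y i) = ⊤)
    (hword : ∀ L : List (ι × G), (∀ e ∈ L, e.2 ∈ π '' Y e.1) →
      (L.Pairwise fun a b => key a.1 ≤ key b.1) →
      (L.IsChain fun a b => a.1 = b.1 → a.2 * b.2 ∉ H.map π) →
      (L.map Prod.snd).prod ∈ H.map π → L = []) :
    Function.Injective π := by
  classical
  refine (injective_iff_map_eq_one π).2 fun g hg => ?_
  -- The word is taken of minimal length over all words for `g`; sorting preserves length, so the
  -- sorted word is minimal too.
  have hex' : ∃ n : ℕ, ∃ L : List (ι × E), L.length = n ∧ (∀ e ∈ L, e.2 ∈ Y e.1) ∧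
      ∃ h ∈ H, g = (L.map Prod.snd).prod * h := by
    obtain ⟨L, hL⟩ := exists_word hHY hinv hgen g
    exact ⟨L.length, L, rfl, hL⟩
  obtain ⟨L₀, hlen, hL₀, h, hh, hg₀⟩ := Nat.find_spec hex'
  obtain ⟨L, hL, hs, hl, hprod⟩ := exists_sorted hex L₀ hL₀
  have hgL : g = (L.map Prod.snd).prod * h := by rw [hprod, hg₀]
  have hred : L.IsChain fun a b => a.1 = b.1 → π a.2 * π b.2 ∉ H.map π := by
    rw [List.isChain_iff_forall_rel_of_append_cons_cons]
    rintro a b L₁ L₂ e hab hmem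
    have ha : a.2 ∈ Y a.1 := hL a (by simp [e])
    have hb : b.2 ∈ Y a.1 := hab ▸ hL b (by simp [e])
    have hab' := hcancel _ _ ha _ hb hmem
    have hlt : L₁.length + L₂.length < Nat.find hex' := by
      rw [← hlen, ← hl, e]; simp
    refine Nat.find_min hex' hlt ?_
    -- A cancelling pair multiplies to an element of `H`, which the final factor absorbs if the pair
    -- ends the word and the next letter absorbs otherwise. Either way the word becomes shorter.
    cases L₂ with
    | nil =>
      refine ⟨L₁, by simp, fun f hf => hL f (by simp [e, hf]), a.2 * b.2 * h, mul_mem hab' hh, ?_⟩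
      rw [hgL, e]
      simp [mul_assoc]
    | cons c L₂ =>
      refine ⟨L₁ ++ (c.1, a.2 * b.2 * c.2) :: L₂, by simp, fun f hf => ?_, h, hh, ?_⟩
      · rcases List.mem_append.1 hf with hf | hf
        · exact hL f (by simp [e, hf])
        · rcases List.mem_cons.1 hf with rfl | hf
          · exact hHY _ _ hab' _ (hL c (by simp [e]))
          · exact hL f (by simp [e, hf])
      · rw [hgL, e]
        simp [mul_assoc]
  have hnil := hword (L.map fun e => (e.1, π e.2))
    (by
      intro e he
      obtain ⟨f, hf, rfl⟩ := List.mem_map.1 he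
      exact ⟨f.2, hL f hf, rfl⟩)
    (by simpa [List.pairwise_map] using hs)
    (by rw [List.isChain_map]; simpa using hred)
    (by
      have e : ((L.map fun e => (e.1, π e.2)).map Prod.snd).prod = π (L.map Prod.snd).prod := by
        rw [map_list_prod, List.map_map, List.map_map]; rfl
      rw [e]
      refine ⟨h⁻¹, H.inv_mem hh, ?_⟩
      rw [hgL, map_mul] at hg
      rw [map_inv, eq_comm]
      exact eq_inv_of_mul_eq_one_left hg)
  have hLnil : L = [] := by simpa using hnil
  rw [hLnil] at hgL
  have hgh : g = h := by simpa using hgL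
  rw [hgh] at hg ⊢
  exact hinj h hh hg

end NormalForm

/-! ### The presentation -/

section PresentationProof

variable {S : Finset Nat.Primes} {A : S → Set (GamBar S)}

lemma IsRightOrbitSystem.exists_eq_mul {p : ℕ} {B : Set (GamBar S)} (hB : IsRightOrbitSystem p B)
    {x : GamBar S} (hx : x ∈ normBar S p) : ∃ σ ∈ B, ∃ u ∈ unitsBar S, x = σ * u := by
  obtain ⟨g, hg, rfl⟩ := hx
  obtain ⟨σ, ⟨hσ, u, hu, e⟩, -⟩ := hB.2 g hg
  exact ⟨σ, hσ, u⁻¹, inv_mem hu, by rw [e, mul_inv_cancel_right]⟩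

lemma IsLeftOrbitSystem.exists_eq_mul {p : ℕ} {B : Set (GamBar S)} (hB : IsLeftOrbitSystem p B)
    {x : GamBar S} (hx : x ∈ normBar S p) : ∃ σ ∈ B, ∃ u ∈ unitsBar S, x = u * σ := by
  obtain ⟨g, hg, rfl⟩ := hx
  obtain ⟨σ, ⟨hσ, u, hu, e⟩, -⟩ := hB.2 g hg
  exact ⟨σ, hσ, u⁻¹, inv_mem hu, by rw [e, inv_mul_cancel_left]⟩

/-- The evaluation of words in the generators. -/
def evalWord (A : S → Set (GamBar S)) : FreeGroup (gens A) →* GamBar S :=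
  FreeGroup.lift fun x => (x : GamBar S)

lemma evalWord_letter {x : GamBar S} (hx : x ∈ gens A ∨ x = 1) : evalWord A (letter A x) = x := by
  by_cases h : x ∈ gens A
  · rw [letter, dif_pos h, evalWord, FreeGroup.lift_apply_of]
  · rw [letter, dif_neg h, map_one, hx.resolve_left h]

lemma mem_gens_of_mem {p : S} {x : GamBar S} (hx : x ∈ A p) : x ∈ gens A :=
  Or.inr (Set.mem_iUnion.2 ⟨p, hx⟩)

lemma mem_gens_or_eq_one {x : GamBar S} (hx : x ∈ unitsBar S) : x ∈ gens A ∨ x = 1 := by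
  by_cases h : x = 1
  · exact Or.inr h
  · exact Or.inl (Or.inl ⟨hx, h⟩)

lemma one_notMem_gens (hA : ∀ p : S, IsRightOrbitSystem ((p : Nat.Primes) : ℕ) (A p)) :
    (1 : GamBar S) ∉ gens A := by
  rintro (h | h)
  · exact h.2 rfl
  · obtain ⟨p, hp⟩ := Set.mem_iUnion.1 h
    exact one_notMem_normBar p.1 ((hA p).1 hp)

lemma letter_one (hA : ∀ p : S, IsRightOrbitSystem ((p : Nat.Primes) : ℕ) (A p)) :
    letter A 1 = 1 := dif_neg (one_notMem_gens hA)

lemma evalWord_rel_eq_one {R : Set (FreeGroup (gens A))} (hR : ∀ r ∈ R, evalWord A r = 1) :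
    ∀ r ∈ rel1 A ∪ rel2 A ∪ R ∪ rel4 A, evalWord A r = 1 := by
  have hu : ∀ {x}, x ∈ unitsBar S → evalWord A (letter A x) = x :=
    fun hx => evalWord_letter (mem_gens_or_eq_one hx)
  have hp : ∀ {p x}, x ∈ A p → evalWord A (letter A x) = x :=
    fun hx => evalWord_letter (Or.inl (mem_gens_of_mem hx))
  rintro r (((⟨σ, hσ, τ, hτ, ν, hν, e, rfl⟩ | ⟨p, σ, hσ, τ, hτ, ν, hν, e, rfl⟩) | h) |
    ⟨p, σ, hσ, τ, hτ, ν, hν, μ, hμ, e, rfl⟩)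
  · rw [map_mul, map_mul, map_inv, hu hσ.1, hu hτ.1, hu hν.1, e, mul_inv_cancel]
  · rw [map_mul, map_mul, map_inv, hp hσ, hp hτ, hu hν, e, mul_inv_cancel]
  · exact hR r h
  · rw [map_mul, map_mul, map_inv, map_mul, hp hσ, hp hτ, hu hν, hu hμ, e, mul_inv_cancel]

lemma evalWord_rel3Right : ∀ r ∈ rel3Right A, evalWord A r = 1 := by
  rintro r ⟨p, q, -, σ, hσ, β, hβ, τ, hτ, α, hα, ν, hν, e, rfl⟩
  have hp : ∀ {p x}, x ∈ A p → evalWord A (letter A x) = x :=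
    fun hx => evalWord_letter (Or.inl (mem_gens_of_mem hx))
  rw [map_mul, map_mul, map_inv, map_mul, map_mul, hp hσ, hp hτ, hp hα, hp hβ,
    evalWord_letter (mem_gens_or_eq_one hν), e, mul_inv_cancel]

lemma evalWord_rel3Left : ∀ r ∈ rel3Left A, evalWord A r = 1 := by
  rintro r ⟨p, q, -, σ, hσ, β, hβ, τ, hτ, α, hα, ν, hν, e, rfl⟩
  have hp : ∀ {p x}, x ∈ A p → evalWord A (letter A x) = x :=
    fun hx => evalWord_letter (Or.inl (mem_gens_of_mem hx))
  rw [map_mul, map_mul, map_inv, map_mul, map_mul, hp hσ, hp hτ, hp hα, hp hβ,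
    evalWord_letter (mem_gens_or_eq_one hν), e, mul_inv_cancel]

/-- The presentation, with relations of type (3) that suffice to sort words. -/
theorem presents_of_exchange
    (hA : ∀ p : S, IsRightOrbitSystem ((p : Nat.Primes) : ℕ) (A p))
    (hU : ∀ σ ∈ unitsBar S, ∃ τ ∈ unitsBar S, τ ≠ 1 ∧ σ * τ ≠ 1)
    (R : Set (FreeGroup (gens A))) (hR : ∀ r ∈ R, evalWord A r = 1)
    (hex : ∀ p q : S, (q : Nat.Primes).1 < (p : Nat.Primes).1 → ∀ σ ∈ A p, ∀ τ ∈ A q,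
      ∃ β ∈ A p, ∃ α ∈ A q, ∃ ν ∈ unitsBar S,
        letter A σ * letter A τ * (letter A α * letter A β * letter A ν)⁻¹ ∈ R ∨
        letter A σ * letter A τ * (letter A ν * letter A α * letter A β)⁻¹ ∈ R) :
    Presents A (rel1 A ∪ rel2 A ∪ R ∪ rel4 A) := by
  set R' := rel1 A ∪ rel2 A ∪ R ∪ rel4 A with hR'
  let m : FreeGroup (gens A) →* PresentedGroup R' := PresentedGroup.mk R'
  let l : GamBar S → PresentedGroup R' := fun x => m (letter A x)
  have hsound : ∀ r ∈ R', FreeGroup.lift (fun x : gens A => (x : GamBar S)) r = 1 :=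
    evalWord_rel_eq_one hR
  let π : PresentedGroup R' →* GamBar S := PresentedGroup.toGroup hsound
  have hπ : ∀ w, π (m w) = evalWord A w := fun w => rfl
  have hπu : ∀ {x}, x ∈ unitsBar S → π (l x) = x :=
    fun hx => (hπ _).trans (evalWord_letter (mem_gens_or_eq_one hx))
  have hπp : ∀ {p x}, x ∈ A p → π (l x) = x :=
    fun hx => (hπ _).trans (evalWord_letter (Or.inl (mem_gens_of_mem hx)))
  have hm : ∀ a b, a * b⁻¹ ∈ R' → m a = m b := by
    intro a b h
    have : m (a * b⁻¹) = 1 := PresentedGroup.one_of_mem h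
    rwa [map_mul, map_inv, mul_inv_eq_one] at this
  have l1 : l 1 = 1 := by
    change m (letter A 1) = 1
    rw [letter_one hA, map_one]
  have r1 : ∀ σ ∈ unitsBar S, ∀ τ ∈ unitsBar S, σ * τ ≠ 1 → l σ * l τ = l (σ * τ) := by
    intro σ hσ τ hτ h
    by_cases hσ1 : σ = 1
    · rw [hσ1, l1, one_mul, one_mul]
    by_cases hτ1 : τ = 1
    · rw [hτ1, l1, mul_one, mul_one]
    change m _ * m _ = m _
    rw [← map_mul]
    exact hm _ _ (Or.inl (Or.inl (Or.inl ⟨σ, ⟨hσ, hσ1⟩, τ, ⟨hτ, hτ1⟩, _, ⟨mul_mem hσ hτ, h⟩, rfl, rfl⟩)))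
  have r1' : ∀ σ ∈ unitsBar S, ∀ τ ∈ unitsBar S, l σ * l τ = l (σ * τ) := by
    intro σ hσ τ hτ
    by_cases h : σ * τ = 1
    -- Type 1 does not contain `σ * σ⁻¹ = 1`, as its product must be nontrivial. With `ρ` different
    -- from `1` and `τ⁻¹`, the relations for `τ * ρ` and for `σ * (τ * ρ) = ρ` yield it.
    · obtain ⟨ρ, hρ, hρ1, hρ2⟩ := hU τ hτ
      have e1 := r1 τ hτ ρ hρ hρ2
      have e2 := r1 σ hσ (τ * ρ) (mul_mem hτ hρ) (by rwa [← mul_assoc, h, one_mul])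
      rw [← e1, ← mul_assoc, ← mul_assoc, h, one_mul] at e2
      rw [h, l1]
      exact mul_eq_right.1 e2
    · exact r1 σ hσ τ hτ h
  have r2 : ∀ p, ∀ σ ∈ A p, ∀ τ ∈ A p, σ * τ ∈ unitsBar S → l σ * l τ = l (σ * τ) := by
    intro p σ hσ τ hτ h
    change m _ * m _ = m _
    rw [← map_mul]
    exact hm _ _ (Or.inl (Or.inl (Or.inr ⟨p, σ, hσ, τ, hτ, _, h, rfl, rfl⟩)))
  have r4 : ∀ p, ∀ σ ∈ A p, ∀ ν ∈ unitsBar S,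
      ∃ τ ∈ A p, ∃ μ ∈ unitsBar S, ν * σ = τ * μ ∧ l ν * l σ = l τ * l μ := by
    intro p σ hσ ν hν
    obtain ⟨τ, hτ, μ, hμ, e⟩ :=
      (hA p).exists_eq_mul (unit_mul_mem_normBar ((hA p).1 hσ) hν)
    refine ⟨τ, hτ, μ, hμ, e, ?_⟩
    change m _ * m _ = m _ * m _
    rw [← map_mul, ← map_mul]
    exact hm _ _ (Or.inr ⟨p, σ, hσ, τ, hτ, ν, hν, μ, hμ, e, rfl⟩)
  let f : unitsBar S →* PresentedGroup R' :=
    { toFun := fun u => l u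
      map_one' := l1
      map_mul' := fun u v => (r1' u u.2 v v.2).symm }
  -- `Y p` lifts all norm `p` classes, since `A p` represents the right orbits; a lift is a
  -- generator followed by a unit.
  let Y : S → Set (PresentedGroup R') :=
    fun p => {g | ∃ σ ∈ A p, ∃ u ∈ unitsBar S, g = l σ * l u}
  have hmem : ∀ {u}, u ∈ unitsBar S → l u ∈ f.range := fun {u} hu => ⟨⟨u, hu⟩, rfl⟩
  have hmap : f.range.map π = unitsBar S := by
    ext x
    constructor
    · rintro ⟨_, ⟨u, rfl⟩, rfl⟩
      change π (l u) ∈ _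
      rw [hπu u.2]
      exact u.2
    · exact fun hx => ⟨l x, hmem hx, hπu hx⟩
  have hYH : ∀ p, ∀ h ∈ f.range, ∀ y ∈ Y p, y * h ∈ Y p := by
    rintro p _ ⟨v, rfl⟩ _ ⟨σ, hσ, u, hu, rfl⟩
    exact ⟨σ, hσ, u * v, mul_mem hu v.2, by rw [mul_assoc, ← r1' u hu v v.2]; rfl⟩
  have hHY : ∀ p, ∀ h ∈ f.range, ∀ y ∈ Y p, h * y ∈ Y p := by
    rintro p _ ⟨v, rfl⟩ _ ⟨σ, hσ, u, hu, rfl⟩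
    obtain ⟨τ, hτ, μ, hμ, -, e⟩ := r4 p σ hσ v v.2
    refine ⟨τ, hτ, μ * u, mul_mem hμ hu, ?_⟩
    change l v * (l σ * l u) = _
    rw [← mul_assoc, e, mul_assoc, r1' μ hμ u hu]
  have hlY : ∀ {p σ}, σ ∈ A p → l σ ∈ Y p :=
    fun {p σ} hσ => ⟨σ, hσ, 1, one_mem _, by rw [l1, mul_one]⟩
  have hπY : ∀ p, ∀ y ∈ Y p, π y ∈ normBar S (p : Nat.Primes) := by
    rintro p _ ⟨σ, hσ, u, hu, rfl⟩
    rw [map_mul, hπp hσ, hπu hu]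
    exact mul_unit_mem_normBar ((hA p).1 hσ) hu
  have hYnorm : ∀ p, π '' Y p = normBar S (p : Nat.Primes) := by
    intro p
    refine Set.Subset.antisymm (Set.image_subset_iff.2 (hπY p)) fun x hx => ?_
    obtain ⟨σ, hσ, u, hu, rfl⟩ := (hA p).exists_eq_mul hx
    exact ⟨l σ * l u, ⟨σ, hσ, u, hu, rfl⟩, by rw [map_mul, hπp hσ, hπu hu]⟩
  have hinv : ∀ p, ∀ y ∈ Y p, y⁻¹ ∈ Y p := by
    rintro p _ ⟨σ, hσ, u, hu, rfl⟩
    -- Writing `σ⁻¹ = τ v` in `Γ̄_S` makes `σ * τ` a unit, so a type 2 relation expresses the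
    -- inverse of the generator.
    obtain ⟨τ, hτ, v, hv, e⟩ := (hA p).exists_eq_mul (inv_mem_normBar p.2 ((hA p).1 hσ))
    have e2 : σ * τ = v⁻¹ := by
      rw [eq_inv_iff_mul_eq_one, mul_assoc, ← e, mul_inv_cancel]
    have e3 := r2 p σ hσ τ hτ (by rw [e2]; exact inv_mem hv)
    rw [e2] at e3
    rw [mul_inv_rev]
    refine hHY p _ (inv_mem (hmem hu)) _ ?_
    have e4 : (l σ)⁻¹ = l τ * (l v⁻¹)⁻¹ := by
      rw [← e3, mul_inv_rev, mul_inv_cancel_left]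
    rw [e4]
    exact hYH p _ (inv_mem (hmem (inv_mem hv))) _ (hlY hτ)
  have hcancel : ∀ p, ∀ y ∈ Y p, ∀ y' ∈ Y p, π y * π y' ∈ f.range.map π → y * y' ∈ f.range := by
    rintro p _ ⟨σ, hσ, u, hu, rfl⟩ _ ⟨τ, hτ, v, hv, rfl⟩ h
    -- Type 4 moves the inner unit to the right, leaving two generators of `A p` whose product is a
    -- unit, to which type 2 applies.
    obtain ⟨ρ, hρ, w, hw, e, e'⟩ := r4 p τ hτ u hu
    have e3 : l σ * l u * (l τ * l v) = l σ * l ρ * (l w * l v) := by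
      rw [mul_assoc, ← mul_assoc (l u), e']
      simp only [mul_assoc]
    rw [hmap, ← map_mul, e3] at h
    rw [map_mul, map_mul, map_mul, hπp hσ, hπp hρ, hπu hw, hπu hv] at h
    have hσρ : σ * ρ ∈ unitsBar S :=
      (Subgroup.mul_mem_cancel_right _ (mul_mem hw hv)).1 h
    rw [e3, r2 p σ hσ ρ hρ hσρ]
    exact mul_mem (hmem hσρ) (mul_mem (hmem hw) (hmem hv))
  have hexch : ∀ p q : S, (q : Nat.Primes).1 < (p : Nat.Primes).1 → ∀ y ∈ Y p, ∀ y' ∈ Y q,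
      ∃ z ∈ Y q, ∃ z' ∈ Y p, y * y' = z * z' := by
    rintro p q hpq _ ⟨σ, hσ, u, hu, rfl⟩ _ ⟨τ, hτ, v, hv, rfl⟩
    obtain ⟨ρ, hρ, w, hw, e, e'⟩ := r4 q τ hτ u hu
    have e3 : l σ * l u * (l τ * l v) = l σ * l ρ * (l w * l v) := by
      rw [mul_assoc, ← mul_assoc (l u), e']
      simp only [mul_assoc]
    obtain ⟨β, hβ, α, hα, ν, hν, h | h⟩ := hex p q hpq σ hσ ρ hρ
    · have e4 := hm _ _ (Or.inl (Or.inr h))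
      simp only [map_mul] at e4
      refine ⟨l α, hlY hα, l β * (l ν * (l w * l v)),
        hYH p _ (mul_mem (hmem hν) (mul_mem (hmem hw) (hmem hv))) _ (hlY hβ), ?_⟩
      rw [e3]
      change m _ * m _ * _ = _
      rw [e4]
      simp only [l, mul_assoc]
    · have e4 := hm _ _ (Or.inl (Or.inr h))
      simp only [map_mul] at e4
      refine ⟨l ν * l α, hHY q _ (hmem hν) _ (hlY hα), l β * (l w * l v),
        hYH p _ (mul_mem (hmem hw) (hmem hv)) _ (hlY hβ), ?_⟩
      rw [e3]
      change m _ * m _ * _ = _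
      rw [e4]
      simp only [l, mul_assoc]
  have hgen : Subgroup.closure ((f.range : Set (PresentedGroup R')) ∪ ⋃ p, Y p) = ⊤ := by
    rw [eq_top_iff, ← PresentedGroup.closure_range_of, Subgroup.closure_le]
    rintro _ ⟨⟨x, hx⟩, rfl⟩
    have e : PresentedGroup.of (rels := R') ⟨x, hx⟩ = l x := by
      change m (FreeGroup.of _) = m (letter A x)
      rw [letter, dif_pos hx]
    rw [e]
    refine Subgroup.subset_closure ?_
    rcases hx with hx | hx
    · exact Or.inl (hmem hx.1)
    · obtain ⟨p, hp⟩ := Set.mem_iUnion.1 hx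
      exact Or.inr (Set.mem_iUnion.2 ⟨p, hlY hp⟩)
  have hinj : Function.Injective π := by
    refine injective_of_words (key := fun p : S => ((p : Nat.Primes) : ℕ)) π ?_ hHY hinv hcancel
      hexch hgen ?_
    · rintro _ ⟨u, rfl⟩ h
      have h2 : (u : GamBar S) = 1 := (hπu u.2).symm.trans h
      change l u = 1
      rw [h2, l1]
    · intro L hL hs hc h
      rw [hmap] at hc h
      exact word_eq_nil L (fun e he => hYnorm e.1 ▸ hL e he) hs hc h
  have hsurj : Function.Surjective π := by
    rw [← MonoidHom.range_eq_top, eq_top_iff, ← closure_eq_top, Subgroup.closure_le]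
    rintro x (hx | hx)
    · exact ⟨l x, hπu hx⟩
    · obtain ⟨p, hp⟩ := Set.mem_iUnion.1 hx
      rw [← hYnorm] at hp
      obtain ⟨y, -, rfl⟩ := hp
      exact ⟨y, rfl⟩
  exact ⟨MulEquiv.ofBijective π ⟨hinj, hsurj⟩, fun x => PresentedGroup.toGroup.of hsound⟩

lemma exists_exchange_right (hA : ∀ p : S, IsRightOrbitSystem ((p : Nat.Primes) : ℕ) (A p))
    (p q : S) (hqp : (q : Nat.Primes).1 < (p : Nat.Primes).1) {σ τ : GamBar S} (hσ : σ ∈ A p)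
    (hτ : τ ∈ A q) : ∃ β ∈ A p, ∃ α ∈ A q, ∃ ν ∈ unitsBar S, σ * τ = α * β * ν := by
  have hne : (p : Nat.Primes) ≠ q := fun e => hqp.ne (by rw [e])
  obtain ⟨y, hy, x, hx, e⟩ := exists_exchange p.2 q.2 hne ((hA p).1 hσ) ((hA q).1 hτ)
  obtain ⟨α, hα, u, hu, rfl⟩ := (hA q).exists_eq_mul hy
  obtain ⟨β, hβ, v, hv, e2⟩ := (hA p).exists_eq_mul (unit_mul_mem_normBar hx hu)
  exact ⟨β, hβ, α, hα, v, hv, by rw [e, mul_assoc, e2, mul_assoc]⟩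

/-- Normalising from the right end by left representatives pushes the surplus units to the front:
first `x = u β`, then `y u = v α`. -/
lemma exists_exchange_left (hA : ∀ p : S, IsRightOrbitSystem ((p : Nat.Primes) : ℕ) (A p))
    (hA' : ∀ p : S, IsLeftOrbitSystem ((p : Nat.Primes) : ℕ) (A p))
    (p q : S) (hqp : (q : Nat.Primes).1 < (p : Nat.Primes).1) {σ τ : GamBar S} (hσ : σ ∈ A p)
    (hτ : τ ∈ A q) : ∃ β ∈ A p, ∃ α ∈ A q, ∃ ν ∈ unitsBar S, σ * τ = ν * α * β := by
  have hne : (p : Nat.Primes) ≠ q := fun e => hqp.ne (by rw [e])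
  obtain ⟨y, hy, x, hx, e⟩ := exists_exchange p.2 q.2 hne ((hA p).1 hσ) ((hA q).1 hτ)
  obtain ⟨β, hβ, u, hu, rfl⟩ := (hA' p).exists_eq_mul hx
  obtain ⟨α, hα, v, hv, e2⟩ := (hA' q).exists_eq_mul (mul_unit_mem_normBar hy hu)
  exact ⟨β, hβ, α, hα, v, hv, by rw [e, ← mul_assoc, e2]⟩

theorem presents_right (hA : ∀ p : S, IsRightOrbitSystem ((p : Nat.Primes) : ℕ) (A p))
    (hU : ∀ σ ∈ unitsBar S, ∃ τ ∈ unitsBar S, τ ≠ 1 ∧ σ * τ ≠ 1) :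
    Presents A (rel1 A ∪ rel2 A ∪ rel3Right A ∪ rel4 A) := by
  refine presents_of_exchange hA hU _ evalWord_rel3Right fun p q hqp σ hσ τ hτ => ?_
  obtain ⟨β, hβ, α, hα, ν, hν, e⟩ := exists_exchange_right hA p q hqp hσ hτ
  exact ⟨β, hβ, α, hα, ν, hν, Or.inl ⟨p, q, hqp, σ, hσ, β, hβ, τ, hτ, α, hα, ν, hν, e, rfl⟩⟩

theorem presents_left (hA : ∀ p : S, IsRightOrbitSystem ((p : Nat.Primes) : ℕ) (A p))
    (hA' : ∀ p : S, IsLeftOrbitSystem ((p : Nat.Primes) : ℕ) (A p))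
    (hU : ∀ σ ∈ unitsBar S, ∃ τ ∈ unitsBar S, τ ≠ 1 ∧ σ * τ ≠ 1) :
    Presents A (rel1 A ∪ rel2 A ∪ rel3Left A ∪ rel4 A) := by
  refine presents_of_exchange hA hU _ evalWord_rel3Left fun p q hqp σ hσ τ hτ => ?_
  obtain ⟨β, hβ, α, hα, ν, hν, e⟩ := exists_exchange_left hA hA' p q hqp hσ hτ
  exact ⟨β, hβ, α, hα, ν, hν, Or.inr ⟨p, q, hqp, σ, hσ, β, hβ, τ, hτ, α, hα, ν, hν, e, rfl⟩⟩

end PresentationProof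

/-! ### The image of the Hurwitz units is the tetrahedral group -/

section Tetrahedral

/-- The vertices of a regular tetrahedron. -/
def tetra : Fin 4 → ℤ × ℤ × ℤ := ![(1, 1, 1), (1, -1, -1), (-1, 1, -1), (-1, -1, 1)]

/-- The pure quaternion with given integral coordinates. -/
def pureQuat (v : ℤ × ℤ × ℤ) : ℍ[ℚ] := ⟨0, v.1, v.2.1, v.2.2⟩

/-- The equation `x v = w x` for a quaternion `x` with coordinates `t` and pure quaternions
`v` and `w`. -/
def Intertwines (t : ℤ × ℤ × ℤ × ℤ) (v w : ℤ × ℤ × ℤ) : Prop :=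
  t.2.1 * v.1 + t.2.2.1 * v.2.1 + t.2.2.2 * v.2.2
    = w.1 * t.2.1 + w.2.1 * t.2.2.1 + w.2.2 * t.2.2.2 ∧
  t.1 * v.1 + t.2.2.1 * v.2.2 - t.2.2.2 * v.2.1
    = w.1 * t.1 + w.2.1 * t.2.2.2 - w.2.2 * t.2.2.1 ∧
  t.1 * v.2.1 - t.2.1 * v.2.2 + t.2.2.2 * v.1
    = w.2.1 * t.1 - w.1 * t.2.2.2 + w.2.2 * t.2.1 ∧
  t.1 * v.2.2 + t.2.1 * v.2.1 - t.2.2.1 * v.1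
    = w.2.2 * t.1 + w.1 * t.2.2.1 - w.2.1 * t.2.1

instance (t : ℤ × ℤ × ℤ × ℤ) (v w : ℤ × ℤ × ℤ) : Decidable (Intertwines t v w) := by
  unfold Intertwines; infer_instance

/-- A finite check that Hurwitz units act on the tetrahedron by even permutations. The tuple holds
doubled coordinates; norm one bounds `d` and `2 * a + d` by `2` in absolute value, hence `a`, and
likewise `b` and `c`, so the box contains every unit. -/
lemma exists_perm_of_norm_eq : ∀ d ∈ Finset.Icc (-2 : ℤ) 2, ∀ a ∈ Finset.Icc (-2 : ℤ) 2,
    ∀ b ∈ Finset.Icc (-2 : ℤ) 2, ∀ c ∈ Finset.Icc (-2 : ℤ) 2,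
    (2 * a + d) ^ 2 + (2 * b + d) ^ 2 + (2 * c + d) ^ 2 + d ^ 2 = 4 →
    ∃ σ : Equiv.Perm (Fin 4), Equiv.Perm.sign σ = 1 ∧
      ∀ i, Intertwines (2 * a + d, 2 * b + d, 2 * c + d, d) (tetra i) (tetra (σ i)) := by
  decide +kernel

/-- The converse finite check, which makes the map from Hurwitz units to even permutations
surjective. -/
lemma exists_norm_eq_of_perm : ∀ σ : Equiv.Perm (Fin 4), Equiv.Perm.sign σ = 1 →
    ∃ d ∈ Finset.Icc (-2 : ℤ) 2, ∃ a ∈ Finset.Icc (-2 : ℤ) 2,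
    ∃ b ∈ Finset.Icc (-2 : ℤ) 2, ∃ c ∈ Finset.Icc (-2 : ℤ) 2,
    (2 * a + d) ^ 2 + (2 * b + d) ^ 2 + (2 * c + d) ^ 2 + d ^ 2 = 4 ∧
      ∀ i, Intertwines (2 * a + d, 2 * b + d, 2 * c + d, d) (tetra i) (tetra (σ i)) := by
  decide +kernel

lemma pureQuat_tetra_injective : Function.Injective fun i => pureQuat (tetra i) := by
  have h : Function.Injective tetra := by decide
  refine Function.Injective.comp (g := pureQuat) ?_ h
  intro v w e
  have h1 : ((v.1 : ℤ) : ℚ) = w.1 := congrArg QuaternionAlgebra.imI e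
  have h2 : ((v.2.1 : ℤ) : ℚ) = w.2.1 := congrArg QuaternionAlgebra.imJ e
  have h3 : ((v.2.2 : ℤ) : ℚ) = w.2.2 := congrArg QuaternionAlgebra.imK e
  exact Prod.ext (by exact_mod_cast h1) (Prod.ext (by exact_mod_cast h2) (by exact_mod_cast h3))

lemma mul_pureQuat_eq {x : ℍ[ℚ]} {t : ℤ × ℤ × ℤ × ℤ} (h1 : 2 * x.re = t.1)
    (h2 : 2 * x.imI = t.2.1) (h3 : 2 * x.imJ = t.2.2.1) (h4 : 2 * x.imK = t.2.2.2)
    {v w : ℤ × ℤ × ℤ} (h : Intertwines t v w) : x * pureQuat v = pureQuat w * x := by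
  obtain ⟨t1, t2, t3, t4⟩ := t
  obtain ⟨v1, v2, v3⟩ := v
  obtain ⟨w1, w2, w3⟩ := w
  obtain ⟨e1, e2, e3, e4⟩ := h
  simp only at h1 h2 h3 h4 e1 e2 e3 e4
  have f1 := congrArg (Int.cast : ℤ → ℚ) e1
  have f2 := congrArg (Int.cast : ℤ → ℚ) e2
  have f3 := congrArg (Int.cast : ℤ → ℚ) e3
  have f4 := congrArg (Int.cast : ℤ → ℚ) e4
  push_cast at f1 f2 f3 f4
  rw [← h1, ← h3, ← h4] at f2
  rw [← h1, ← h2, ← h4] at f3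
  rw [← h1, ← h2, ← h3] at f4
  rw [← h2, ← h3, ← h4] at f1
  ext
  · rw [re_mul, re_mul]; simp only [pureQuat]; linear_combination -f1 / 2
  · rw [imI_mul, imI_mul]; simp only [pureQuat]; linear_combination f2 / 2
  · rw [imJ_mul, imJ_mul]; simp only [pureQuat]; linear_combination f3 / 2
  · rw [imK_mul, imK_mul]; simp only [pureQuat]; linear_combination f4 / 2

lemma exists_perm {x : ℍ[ℚ]} (hx : x ∈ hurwitz) (hN : normSq x = 1) :
    ∃ σ : Equiv.Perm (Fin 4), Equiv.Perm.sign σ = 1 ∧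
      ∀ i, x * pureQuat (tetra i) = pureQuat (tetra (σ i)) * x := by
  obtain ⟨a, b, c, d, h1, h2, h3, h4⟩ := mem_hurwitz_iff.1 hx
  have hsum : (2 * a + d) ^ 2 + (2 * b + d) ^ 2 + (2 * c + d) ^ 2 + d ^ 2 = 4 := by
    rw [normSq_def', h1, h2, h3, h4] at hN
    have : ((2 * a + d) ^ 2 + (2 * b + d) ^ 2 + (2 * c + d) ^ 2 + d ^ 2 : ℚ) = 4 := by
      linear_combination 4 * hN
    exact_mod_cast this
  have bound : ∀ t : ℤ, t ^ 2 ≤ 4 → -2 ≤ t ∧ t ≤ 2 := fun t ht =>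
    abs_le.1 (abs_le_of_sq_le_sq (by simpa using ht) (by norm_num))
  have ba := bound (2 * a + d) (by nlinarith [sq_nonneg (2 * b + d), sq_nonneg (2 * c + d), sq_nonneg d])
  have bb := bound (2 * b + d) (by nlinarith [sq_nonneg (2 * a + d), sq_nonneg (2 * c + d), sq_nonneg d])
  have bc := bound (2 * c + d) (by nlinarith [sq_nonneg (2 * b + d), sq_nonneg (2 * a + d), sq_nonneg d])
  have bd := bound d (by nlinarith [sq_nonneg (2 * b + d), sq_nonneg (2 * c + d), sq_nonneg (2 * a + d)])
  obtain ⟨σ, hσ, h⟩ := exists_perm_of_norm_eq d (Finset.mem_Icc.2 bd) a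
    (Finset.mem_Icc.2 (by omega)) b (Finset.mem_Icc.2 (by omega)) c (Finset.mem_Icc.2 (by omega)) hsum
  refine ⟨σ, hσ, fun i => mul_pureQuat_eq ?_ ?_ ?_ ?_ (h i)⟩ <;>
    simp only [h1, h2, h3, h4] <;> push_cast <;> ring

lemma exists_unit_of_perm {σ : Equiv.Perm (Fin 4)} (hσ : Equiv.Perm.sign σ = 1) :
    ∃ x ∈ hurwitz, normSq x = 1 ∧ ∀ i, x * pureQuat (tetra i) = pureQuat (tetra (σ i)) * x := by
  obtain ⟨d, -, a, -, b, -, c, -, hsum, h⟩ := exists_norm_eq_of_perm σ hσ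
  refine ⟨⟨a + d / 2, b + d / 2, c + d / 2, d / 2⟩,
    mem_hurwitz_iff.2 ⟨a, b, c, d, rfl, rfl, rfl, rfl⟩, ?_, fun i =>
      mul_pureQuat_eq ?_ ?_ ?_ ?_ (h i)⟩
  · refine (normSq_def' _).trans ?_
    have : ((2 * a + d) ^ 2 + (2 * b + d) ^ 2 + (2 * c + d) ^ 2 + d ^ 2 : ℚ) = 4 := by
      exact_mod_cast hsum
    linear_combination this / 4
  all_goals push_cast; ring

/-- A quaternion commuting with two non-parallel pure quaternions has no imaginary part; the first
two vertices already suffice. -/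
lemma eq_algebraMap_of_commute {x : ℍ[ℚ]}
    (h : ∀ i, x * pureQuat (tetra i) = pureQuat (tetra i) * x) : ∃ c : ℚ, x = algebraMap ℚ ℍ[ℚ] c := by
  have h0 := h 0
  have h1 := h 1
  have h2 := h 2
  have I0 := congrArg QuaternionAlgebra.imI h0
  have J0 := congrArg QuaternionAlgebra.imJ h0
  have I1 := congrArg QuaternionAlgebra.imI h1
  have J1 := congrArg QuaternionAlgebra.imJ h1
  rw [imI_mul, imI_mul] at I0 I1
  rw [imJ_mul, imJ_mul] at J0 J1
  simp only [pureQuat, tetra, Matrix.cons_val_zero, Matrix.cons_val_one] at I0 J0 I1 J1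
  push_cast at I0 J0 I1 J1
  refine ⟨x.re, ?_⟩
  ext
  · rfl
  · change x.imI = 0; linarith
  · change x.imJ = 0; linarith
  · change x.imK = 0; linarith

variable (S : Finset Nat.Primes)

lemma exists_perm_units (u : hurwitzˣ) : ∃ σ : Equiv.Perm (Fin 4), Equiv.Perm.sign σ = 1 ∧
    ∀ i, (u.1 : ℍ[ℚ]) * pureQuat (tetra i) = pureQuat (tetra (σ i)) * u.1 :=
  exists_perm u.1.2 (normSq_unit u)

lemma unit_ne_zero (u : hurwitzˣ) : (u.1 : ℍ[ℚ]) ≠ 0 := by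
  have h : (u.1 : ℍ[ℚ]) * (u⁻¹).1 = 1 := congrArg Subtype.val u.mul_inv
  exact left_ne_zero_of_mul_eq_one h

/-- The permutation of the vertices of the tetrahedron given by a Hurwitz unit. -/
def unitPerm : hurwitzˣ →* Equiv.Perm (Fin 4) :=
  MonoidHom.mk' (fun u => (exists_perm_units u).choose) (by
    intro u w
    ext i
    refine congrArg Fin.val (pureQuat_tetra_injective ?_)
    have hu := (exists_perm_units u).choose_spec.2
    have hw := (exists_perm_units w).choose_spec.2
    have huw := (exists_perm_units (u * w)).choose_spec.2 i
    refine mul_right_cancel₀ (unit_ne_zero (u * w)) ?_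
    rw [← huw]
    change (u.1 : ℍ[ℚ]) * w.1 * _ = _ * (u.1 * w.1)
    rw [mul_assoc, hw i, ← mul_assoc, hu, mul_assoc]
    rfl)

lemma unitPerm_spec (u : hurwitzˣ) (i : Fin 4) :
    (u.1 : ℍ[ℚ]) * pureQuat (tetra i) = pureQuat (tetra (unitPerm u i)) * u.1 :=
  (exists_perm_units u).choose_spec.2 i

lemma range_unitPerm : unitPerm.range = alternatingGroup (Fin 4) := by
  ext σ
  rw [Equiv.Perm.mem_alternatingGroup]
  constructor
  · rintro ⟨u, rfl⟩
    exact (exists_perm_units u).choose_spec.1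
  · intro hσ
    obtain ⟨x, hx, hN, h⟩ := exists_unit_of_perm hσ
    have hN' : normSq x = (1 : ℕ) := by simpa using hN
    let u : hurwitzˣ := ⟨⟨x, hx⟩, ⟨star x, star_mem_hurwitz hx⟩,
      Subtype.ext ((mul_star_eq hN').trans Nat.cast_one),
      Subtype.ext ((star_mul_eq hN').trans Nat.cast_one)⟩
    refine ⟨u, Equiv.ext fun i => pureQuat_tetra_injective ?_⟩
    refine mul_right_cancel₀ (unit_ne_zero u) ?_
    exact (unitPerm_spec u i).symm.trans (h i)

/-- The map from the Hurwitz units to `Γ̄_S`. -/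
def unitBar : hurwitzˣ →* GamBar S :=
  bar.comp (Units.map (Subring.inclusion (hurwitz_le_sOrder S)).toMonoidHom)

/-- Both kernels are the scalar units, so `Ō^*` and the permutation group are the same quotient of
the Hurwitz units. -/
lemma ker_unitBar : (unitBar S).ker = unitPerm.ker := by
  ext u
  rw [MonoidHom.mem_ker, MonoidHom.mem_ker]
  have e : unitBar S u = 1 ↔ ∃ c : ℚ, (u.1 : ℍ[ℚ]) = algebraMap ℚ ℍ[ℚ] c :=
    bar_eq_one_iff (g := Units.map (Subring.inclusion (hurwitz_le_sOrder S)).toMonoidHom u)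
  rw [e]
  constructor
  · rintro ⟨c, hc⟩
    refine Equiv.ext fun i => pureQuat_tetra_injective ?_
    refine mul_right_cancel₀ (unit_ne_zero u) ?_
    refine (unitPerm_spec u i).symm.trans ?_
    rw [hc]
    exact Algebra.commutes c _
  · intro h
    refine eq_algebraMap_of_commute fun i => ?_
    rw [unitPerm_spec u i, h]
    rfl

/-- `Ō^*` is the alternating group on four letters. -/
def unitsBarEquiv : unitsBar S ≃* alternatingGroup (Fin 4) :=
  (QuotientGroup.quotientKerEquivRange (unitBar S)).symm.trans
    ((QuotientGroup.quotientMulEquivOfEq (ker_unitBar S)).trans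
      ((QuotientGroup.quotientKerEquivRange unitPerm).trans
        (MulEquiv.subgroupCongr range_unitPerm)))

lemma card_unitsBar : Nat.card (unitsBar S) = 12 := by
  rw [Nat.card_congr (unitsBarEquiv S).toEquiv, nat_card_alternatingGroup, Nat.card_fin]
  rfl

instance finite_unitsBar : Finite (unitsBar S) :=
  Finite.of_equiv _ (unitsBarEquiv S).symm.toEquiv

lemma ncard_A0 : (A0 S).ncard = 11 := by
  have h : A0 S = (unitsBar S : Set (GamBar S)) \ {1} := rfl
  have hc : (unitsBar S : Set (GamBar S)).ncard = 12 := card_unitsBar S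
  rw [h, Set.ncard_sdiff_singleton_of_mem (one_mem (unitsBar S)), hc]

/-- This is what derives `σ * σ⁻¹ = 1` from type 1 relations; a group with at least three elements
would do. -/
lemma exists_third_unit : ∀ σ ∈ unitsBar S, ∃ τ ∈ unitsBar S, τ ≠ 1 ∧ σ * τ ≠ 1 := by
  intro σ _
  by_contra h
  push Not at h
  have hsub : (unitsBar S : Set (GamBar S)) ⊆ {1, σ⁻¹} := by
    intro τ hτ
    by_cases h1 : τ = 1
    · exact Or.inl h1
    · exact Or.inr (eq_inv_of_mul_eq_one_right (h τ hτ h1))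
  have hc : (unitsBar S : Set (GamBar S)).ncard = 12 := card_unitsBar S
  have := (Set.ncard_le_ncard hsub (Set.toFinite _)).trans (Set.ncard_insert_le _ _)
  rw [Set.ncard_singleton] at this
  omega

end Tetrahedral

/-! ### Common representatives of left and right orbits -/

section TwoSided

lemma card_filter_mem_of_card_fibre {α β : Type*} [DecidableEq β] {X : Finset α} {f : α → β} {n : ℕ}
    (hf : ∀ x ∈ X, (X.filter fun y => f y = f x).card = n) {s : Finset β} (hs : s ⊆ X.image f) :
    (X.filter fun x => f x ∈ s).card = s.card * n := by
  rw [← Finset.sum_card_fiberwise_eq_card_filter, Finset.sum_const_nat]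
  intro b hb
  obtain ⟨x, hx, rfl⟩ := Finset.mem_image.1 (hs hb)
  exact hf x hx

/-- If the nonempty fibres of `f` and `g` on a finite set all have `n > 0` elements, the fibres
have a common system of representatives. -/
theorem exists_common_representatives {α β γ : Type*} [DecidableEq β] [DecidableEq γ]
    (X : Finset α) (f : α → β) (g : α → γ) {n : ℕ} (hn : 0 < n)
    (hf : ∀ x ∈ X, (X.filter fun y => f y = f x).card = n)
    (hg : ∀ x ∈ X, (X.filter fun y => g y = g x).card = n) :
    ∃ A : Set α, A ⊆ X ∧ (∀ x ∈ X, ∃! a, a ∈ A ∧ f a = f x) ∧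
      ∀ x ∈ X, ∃! a, a ∈ A ∧ g a = g x := by
  let t : {b // b ∈ X.image f} → Finset γ := fun b => (X.filter fun x => f x = b.1).image g
  -- Hall's theorem matches `f`-fibres with `g`-fibres that meet them. The union of `k` fibres of
  -- `f` has `k * n` elements, and the `g`-fibres meeting it cover it with `n` elements each, so
  -- there are at least `k` of them.
  obtain ⟨F, hF, hFt⟩ := (Finset.all_card_le_biUnion_card_iff_exists_injective t).1 (by
    intro s
    have h1 := card_filter_mem_of_card_fibre hf (s := s.map (Function.Embedding.subtype _)) (by
      intro b hb
      obtain ⟨b, -, rfl⟩ := Finset.mem_map.1 hb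
      exact b.2)
    have h2 := card_filter_mem_of_card_fibre hg (s := s.biUnion t) (by
      intro c hc
      obtain ⟨b, -, hc⟩ := Finset.mem_biUnion.1 hc
      exact Finset.image_subset_image (Finset.filter_subset _ _) hc)
    rw [Finset.card_map] at h1
    refine Nat.le_of_mul_le_mul_right (h1.symm.trans_le ((Finset.card_le_card ?_).trans_eq h2)) hn
    intro x hx
    obtain ⟨hxX, hx⟩ := Finset.mem_filter.1 hx
    obtain ⟨b, hb, e⟩ := Finset.mem_map.1 hx
    exact Finset.mem_filter.2 ⟨hxX, Finset.mem_biUnion.2 ⟨b, hb,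
      Finset.mem_image_of_mem g (Finset.mem_filter.2 ⟨hxX, e.symm⟩)⟩⟩)
  have hpick : ∀ b, ∃ x ∈ X, f x = b.1 ∧ g x = F b := by
    intro b
    obtain ⟨x, hx, e⟩ := Finset.mem_image.1 (hFt b)
    obtain ⟨hxX, hx⟩ := Finset.mem_filter.1 hx
    exact ⟨x, hxX, hx, e⟩
  choose pick hpX hpf hpg using hpick
  -- Equal fibre sizes give equally many fibres on both sides, so the matching reaches every fibre
  -- of `g`.
  have hcard : (X.image f).card = (X.image g).card := by
    have h1 := card_filter_mem_of_card_fibre hf (Finset.Subset.refl (X.image f))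
    have h2 := card_filter_mem_of_card_fibre hg (Finset.Subset.refl (X.image g))
    rw [Finset.filter_true_of_mem fun x hx => Finset.mem_image_of_mem _ hx] at h1 h2
    exact Nat.eq_of_mul_eq_mul_right hn (h1.symm.trans h2)
  have hsurj : ∀ c ∈ X.image g, ∃ b, F b = c := by
    have himg : (Finset.univ.image F) = X.image g := by
      refine Finset.eq_of_subset_of_card_le ?_ ?_
      · intro c hc
        obtain ⟨b, -, rfl⟩ := Finset.mem_image.1 hc
        exact Finset.image_subset_image (Finset.filter_subset _ _) (hFt b)
      · rw [Finset.card_image_of_injective _ hF, Finset.card_univ, Fintype.card_coe, hcard]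
    intro c hc
    rw [← himg] at hc
    obtain ⟨b, -, e⟩ := Finset.mem_image.1 hc
    exact ⟨b, e⟩
  refine ⟨Set.range pick, ?_, ?_, ?_⟩
  · rintro _ ⟨b, rfl⟩
    exact hpX b
  · intro x hx
    refine ⟨pick ⟨f x, Finset.mem_image_of_mem f hx⟩, ⟨⟨_, rfl⟩, hpf _⟩, ?_⟩
    rintro _ ⟨⟨b, rfl⟩, e⟩
    rw [hpf] at e
    exact congrArg pick (Subtype.ext e)
  · intro x hx
    obtain ⟨b, hb⟩ := hsurj (g x) (Finset.mem_image_of_mem g hx)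
    refine ⟨pick b, ⟨⟨_, rfl⟩, (hpg b).trans hb⟩, ?_⟩
    rintro _ ⟨⟨b', rfl⟩, e⟩
    rw [hpg, ← hb] at e
    exact congrArg pick (hF e)

theorem exists_two_sided_representatives {G : Type*} [Group G] (H : Subgroup G) [Finite H]
    {X : Set G} (hX : X.Finite) (hl : ∀ x ∈ X, ∀ u ∈ H, u * x ∈ X)
    (hr : ∀ x ∈ X, ∀ u ∈ H, x * u ∈ X) :
    ∃ A ⊆ X, (∀ x ∈ X, ∃! a, a ∈ A ∧ ∃ u ∈ H, a = x * u) ∧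
      ∀ x ∈ X, ∃! a, a ∈ A ∧ ∃ u ∈ H, a = u * x := by
  classical
  have := Fintype.ofFinite H
  obtain ⟨ρ, hρ⟩ : ∃ ρ : G → G ⧸ H, ∀ x y, ρ y = ρ x ↔ ∃ u ∈ H, y = x * u := by
    refine ⟨fun x => x, fun x y => ?_⟩
    rw [eq_comm, QuotientGroup.eq]
    exact ⟨fun h => ⟨_, h, by group⟩, by rintro ⟨u, hu, rfl⟩; simpa using hu⟩
  -- The coset `H x` is encoded by the left coset of `x⁻¹`.
  obtain ⟨l, hlam⟩ : ∃ l : G → G ⧸ H, ∀ x y, l y = l x ↔ ∃ u ∈ H, y = u * x := by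
    refine ⟨fun x => (x⁻¹ : G), fun x y => ?_⟩
    rw [QuotientGroup.eq, inv_inv]
    exact ⟨fun h => ⟨_, h, by group⟩, by rintro ⟨u, hu, rfl⟩; simpa using hu⟩
  obtain ⟨A, hAX, h1, h2⟩ := exists_common_representatives hX.toFinset ρ l
    (n := Fintype.card H) Fintype.card_pos
    (by
      intro x hx
      have hx' : x ∈ X := by simpa using hx
      have e : (hX.toFinset.filter fun y => ρ y = ρ x)
          = Finset.univ.image fun u : H => x * u := by
        ext y
        simp only [Finset.mem_filter, Set.Finite.mem_toFinset, Finset.mem_image, Finset.mem_univ,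
          true_and, hρ]
        constructor
        · rintro ⟨-, u, hu, rfl⟩
          exact ⟨⟨u, hu⟩, rfl⟩
        · rintro ⟨u, rfl⟩
          exact ⟨hr x hx' u u.2, u, u.2, rfl⟩
      rw [e, Finset.card_image_of_injective, Finset.card_univ]
      exact fun u v h => Subtype.ext (mul_left_cancel h))
    (by
      intro x hx
      have hx' : x ∈ X := by simpa using hx
      have e : (hX.toFinset.filter fun y => l y = l x)
          = Finset.univ.image fun u : H => u * x := by
        ext y
        simp only [Finset.mem_filter, Set.Finite.mem_toFinset, Finset.mem_image, Finset.mem_univ,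
          true_and, hlam]
        constructor
        · rintro ⟨-, u, hu, rfl⟩
          exact ⟨⟨u, hu⟩, rfl⟩
        · rintro ⟨u, rfl⟩
          exact ⟨hl x hx' u u.2, u, u.2, rfl⟩
      rw [e, Finset.card_image_of_injective, Finset.card_univ]
      exact fun u v h => Subtype.ext (mul_right_cancel h))
  simp only [hρ, hlam] at h1 h2
  exact ⟨A, by simpa using hAX, by simpa using h1, by simpa using h2⟩

end TwoSided

/-! ### Local splittings and lattices -/

section Local

variable {p : ℕ} [Fact p.Prime]

lemma exists_padicInt_eq_iff {x : ℚ_[p]} : (∃ z : ℤ_[p], x = z) ↔ ‖x‖ ≤ 1 :=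
  ⟨by rintro ⟨z, rfl⟩; exact z.2, fun h => ⟨⟨x, h⟩, rfl⟩⟩

/-- The homomorphism `ℋ → M₂(ℚ_p)` given by a local splitting. -/
def LocalSplitting.hom (φ : LocalSplitting p) : ℍ[ℚ] →+* Matrix (Fin 2) (Fin 2) ℚ_[p] :=
  ((φ.equiv : (ℚ_[p] ⊗[ℚ] ℍ[ℚ]) →+* Matrix (Fin 2) (Fin 2) ℚ_[p]).comp
    (Algebra.TensorProduct.includeRight : ℍ[ℚ] →ₐ[ℚ] ℚ_[p] ⊗[ℚ] ℍ[ℚ]).toRingHom)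

variable (φ : LocalSplitting p)

lemma LocalSplitting.hom_apply (x : ℍ[ℚ]) : φ.hom x = φ.equiv (1 ⊗ₜ x) := rfl

lemma LocalSplitting.norm_hom_le {x : ℍ[ℚ]} (hx : x ∈ hurwitz) (i j : Fin 2) :
    ‖φ.hom x i j‖ ≤ 1 :=
  exists_padicInt_eq_iff.1 ((φ.map_order _).1 (Submodule.subset_span ⟨x, hx, rfl⟩) i j)

lemma LocalSplitting.mem_span {M : Matrix (Fin 2) (Fin 2) ℚ_[p]} (hM : ∀ i j, ‖M i j‖ ≤ 1) :
    M ∈ Submodule.span ℤ_[p] ((fun x : ℍ[ℚ] => φ.equiv (1 ⊗ₜ x)) '' (hurwitz : Set ℍ[ℚ])) :=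
  (φ.map_order M).2 fun i j => exists_padicInt_eq_iff.2 (hM i j)

/-- A linear functional that is integral on the Hurwitz order is integral on the quaternions
with integral image. -/
lemma LocalSplitting.norm_functional_le (l : ℍ[ℚ] →ₗ[ℚ] ℚ)
    (hl : ∀ x ∈ hurwitz, ∃ n : ℤ, l x = n) {x : ℍ[ℚ]} (hx : ∀ i j, ‖φ.hom x i j‖ ≤ 1) :
    ‖(l x : ℚ_[p])‖ ≤ 1 := by
  -- The `ℚ_p`-linear extension of `l`, read on matrices; by the ultrametric inequality it is
  -- integral on the `ℤ_p`-span of the order.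
  let L : Matrix (Fin 2) (Fin 2) ℚ_[p] →ₗ[ℚ_[p]] ℚ_[p] :=
    (TensorProduct.AlgebraTensorModule.rid ℚ ℚ_[p] ℚ_[p]).toLinearMap ∘ₗ
      (l.baseChange ℚ_[p]) ∘ₗ φ.equiv.symm.toLinearMap
  have hL : ∀ y, L (φ.equiv (1 ⊗ₜ y)) = (l y : ℚ_[p]) := by
    intro y
    simp [L, Algebra.smul_def]
  have key : ∀ M ∈ Submodule.span ℤ_[p]
      ((fun x : ℍ[ℚ] => φ.equiv (1 ⊗ₜ x)) '' (hurwitz : Set ℍ[ℚ])), ‖L M‖ ≤ 1 := by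
    intro M hM
    induction hM using Submodule.span_induction with
    | mem M h =>
      obtain ⟨y, hy, rfl⟩ := h
      obtain ⟨n, hn⟩ := hl y hy
      change ‖L (φ.equiv (1 ⊗ₜ y))‖ ≤ 1
      rw [hL, hn, Rat.cast_intCast]
      exact Padic.norm_int_le_one n
    | zero => simp
    | add M N _ _ h1 h2 =>
      rw [map_add]
      exact (Padic.nonarchimedean _ _).trans (max_le h1 h2)
    | smul a M _ h =>
      have e : L (a • M) = (a : ℚ_[p]) * L M := L.map_smul (a : ℚ_[p]) M
      rw [e, norm_mul]
      exact mul_le_one₀ a.2 (norm_nonneg _) h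
  rw [← hL]
  exact key _ (φ.mem_span hx)

lemma exists_int_of_norm_le {r : ℚ} {n : ℤ} (hr : ‖(r : ℚ_[p])‖ ≤ 1) (h : p * r = n) :
    ∃ m : ℤ, r = m := by
  have hp0 : (p : ℚ) ≠ 0 := by exact_mod_cast (Fact.out : p.Prime).ne_zero
  have hn : ‖(n : ℚ_[p])‖ < 1 := by
    have e : (n : ℚ_[p]) = p * (r : ℚ_[p]) := by exact_mod_cast congrArg (Rat.cast : ℚ → ℚ_[p]) h.symm
    rw [e, norm_mul]
    exact (mul_le_of_le_one_right (norm_nonneg _) hr).trans_lt Padic.norm_p_lt_one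
  obtain ⟨m, rfl⟩ := (Padic.norm_intCast_lt_one_iff).1 hn
  exact ⟨m, mul_left_cancel₀ hp0 (by rw [h]; push_cast; rfl)⟩

/-- A quaternion `x` with integral image lies in the Hurwitz order if `p x` does. -/
lemma LocalSplitting.mem_hurwitz {x : ℍ[ℚ]} (hpx : (p : ℍ[ℚ]) * x ∈ hurwitz)
    (hx : ∀ i j, ‖φ.hom x i j‖ ≤ 1) : x ∈ hurwitz := by
  have hpx' : ∀ l : ℍ[ℚ] →ₗ[ℚ] ℚ, l ((p : ℍ[ℚ]) * x) = p * l x := by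
    intro l
    have : (p : ℍ[ℚ]) * x = (p : ℚ) • x := by rw [Nat.cast_smul_eq_nsmul, nsmul_eq_mul]
    rw [this, map_smul, smul_eq_mul]
  -- Integrality away from `p` comes from `p x`, and at `p` from the matrix entries. It is applied
  -- below to the four coordinate functionals of the `ℤ`-basis of the order.
  have coord : ∀ l : ℍ[ℚ] →ₗ[ℚ] ℚ, (∀ y ∈ hurwitz, ∃ n : ℤ, l y = n) → ∃ m : ℤ, l x = m := by
    intro l hl
    obtain ⟨n, hn⟩ := hl _ hpx
    rw [hpx'] at hn
    exact exists_int_of_norm_le (φ.norm_functional_le l hl hx) hn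
  let lK : ℍ[ℚ] →ₗ[ℚ] ℚ :=
    { toFun := fun y => 2 * y.imK
      map_add' := fun y z => by rw [imK_add]; ring
      map_smul' := fun c y => by rw [imK_smul]; simp only [smul_eq_mul, RingHom.id_apply]; ring }
  let lR : ℍ[ℚ] →ₗ[ℚ] ℚ :=
    { toFun := fun y => y.re - y.imK
      map_add' := fun y z => by rw [re_add, imK_add]; ring
      map_smul' := fun c y => by
        rw [re_smul, imK_smul]; simp only [smul_eq_mul, RingHom.id_apply]; ring }
  let lI : ℍ[ℚ] →ₗ[ℚ] ℚ :=
    { toFun := fun y => y.imI - y.imK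
      map_add' := fun y z => by rw [imI_add, imK_add]; ring
      map_smul' := fun c y => by
        rw [imI_smul, imK_smul]; simp only [smul_eq_mul, RingHom.id_apply]; ring }
  let lJ : ℍ[ℚ] →ₗ[ℚ] ℚ :=
    { toFun := fun y => y.imJ - y.imK
      map_add' := fun y z => by rw [imJ_add, imK_add]; ring
      map_smul' := fun c y => by
        rw [imJ_smul, imK_smul]; simp only [smul_eq_mul, RingHom.id_apply]; ring }
  obtain ⟨d, hd⟩ := coord lK (by
    intro y hy
    obtain ⟨a, b, c, d, h1, h2, h3, h4⟩ := mem_hurwitz_iff.1 hy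
    exact ⟨d, by change 2 * y.imK = _; rw [h4]; ring⟩)
  obtain ⟨a, ha⟩ := coord lR (by
    intro y hy
    obtain ⟨a, b, c, d, h1, h2, h3, h4⟩ := mem_hurwitz_iff.1 hy
    exact ⟨a, by change y.re - y.imK = _; rw [h1, h4]; ring⟩)
  obtain ⟨b, hb⟩ := coord lI (by
    intro y hy
    obtain ⟨a, b, c, d, h1, h2, h3, h4⟩ := mem_hurwitz_iff.1 hy
    exact ⟨b, by change y.imI - y.imK = _; rw [h2, h4]; ring⟩)
  obtain ⟨c, hc⟩ := coord lJ (by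
    intro y hy
    obtain ⟨a, b, c, d, h1, h2, h3, h4⟩ := mem_hurwitz_iff.1 hy
    exact ⟨c, by change y.imJ - y.imK = _; rw [h3, h4]; ring⟩)
  change 2 * x.imK = d at hd
  change x.re - x.imK = a at ha
  change x.imI - x.imK = b at hb
  change x.imJ - x.imK = c at hc
  exact mem_hurwitz_iff.2 ⟨a, b, c, d, by linarith, by linarith, by linarith, by linarith⟩

lemma exists_padicInt_eq_add (a : ℤ_[p]) : ∃ (n : ℕ) (b : ℤ_[p]), a = n + p * b := by
  obtain ⟨n, -, hn⟩ := PadicInt.exists_mem_range a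
  rw [PadicInt.maximalIdeal_eq_span_p, Ideal.mem_span_singleton] at hn
  obtain ⟨b, hb⟩ := hn
  exact ⟨n, b, by rw [← hb]; ring⟩

/-- Integral matrices are approximated by the Hurwitz order. -/
lemma LocalSplitting.exists_eq_add {M : Matrix (Fin 2) (Fin 2) ℚ_[p]} (hM : ∀ i j, ‖M i j‖ ≤ 1) :
    ∃ z ∈ hurwitz, ∃ B : Matrix (Fin 2) (Fin 2) ℚ_[p], (∀ i j, ‖B i j‖ ≤ 1) ∧
      M = φ.hom z + (p : ℚ_[p]) • B := by
  have add_le : ∀ {x y : ℚ_[p]}, ‖x‖ ≤ 1 → ‖y‖ ≤ 1 → ‖x + y‖ ≤ 1 := fun hx hy =>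
    (Padic.nonarchimedean _ _).trans (max_le hx hy)
  induction φ.mem_span hM using Submodule.span_induction with
  | mem M h =>
    obtain ⟨z, hz, rfl⟩ := h
    exact ⟨z, hz, 0, by simp, by simp [LocalSplitting.hom_apply]⟩
  | zero => exact ⟨0, zero_mem _, 0, by simp, by simp⟩
  | add M N hM' hN' h1 h2 =>
    obtain ⟨z, hz, B, hB, rfl⟩ := h1 (fun i j => exists_padicInt_eq_iff.1 ((φ.map_order M).1 hM' i j))
    obtain ⟨w, hw, C, hC, rfl⟩ := h2 (fun i j => exists_padicInt_eq_iff.1 ((φ.map_order N).1 hN' i j))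
    refine ⟨z + w, add_mem hz hw, B + C, fun i j => add_le (hB i j) (hC i j), ?_⟩
    rw [map_add, smul_add]
    abel
  | smul a M hM' h =>
    obtain ⟨z, hz, B, hB, e⟩ := h (fun i j => exists_padicInt_eq_iff.1 ((φ.map_order M).1 hM' i j))
    -- The natural number `n` keeps the approximation in the order, while `p * b` goes into the
    -- error term.
    obtain ⟨n, b, rfl⟩ := exists_padicInt_eq_add a
    refine ⟨n * z, mul_mem (natCast_mem _ n) hz, (b : ℚ_[p]) • M + (n : ℚ_[p]) • B, fun i j => ?_, ?_⟩
    · refine add_le ?_ ?_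
      · rw [Matrix.smul_apply, smul_eq_mul, norm_mul]
        exact mul_le_one₀ b.2 (norm_nonneg _)
          (exists_padicInt_eq_iff.1 ((φ.map_order M).1 hM' i j))
      · rw [Matrix.smul_apply, smul_eq_mul, norm_mul]
        refine mul_le_one₀ ?_ (norm_nonneg _) (hB i j)
        exact_mod_cast Padic.norm_int_le_one (p := p) n
    · have e1 : ((n + p * b : ℤ_[p])) • M = (n : ℚ_[p]) • M + ((p : ℚ_[p]) * b) • M := by
        rw [← add_smul]
        change (((n + p * b : ℤ_[p])) : ℚ_[p]) • M = _
        push_cast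
        rfl
      rw [e1, map_mul, map_natCast, smul_add, smul_smul, smul_smul]
      conv_lhs => rw [e, smul_add, smul_smul]
      rw [← e, mul_comm (p : ℚ_[p]) n, Nat.cast_smul_eq_nsmul, nsmul_eq_mul]
      abel

end Local

open Matrix

/-! ### Neighbours of the base vertex -/

section Lattices

variable {p : ℕ} [Fact p.Prime]

lemma mem_stdLat {v : Fin 2 → ℚ_[p]} : v ∈ (stdLat p).1 ↔ ∀ i, ‖v i‖ ≤ 1 := by
  constructor
  · intro h i
    change v ∈ Submodule.span _ _ at h
    induction h using Submodule.span_induction with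
    | mem v h =>
      obtain ⟨j, rfl⟩ := h
      rw [Pi.basisFun_apply]
      by_cases hij : i = j
      · subst hij; simp
      · simp [hij]
    | zero => simp
    | add v w _ _ hv hw => exact (Padic.nonarchimedean _ _).trans (max_le hv hw)
    | smul a v _ hv =>
      have e : (a • v) i = (a : ℚ_[p]) * v i := rfl
      rw [e, norm_mul]
      exact mul_le_one₀ a.2 (norm_nonneg _) hv
  · intro h
    let z : Fin 2 → ℤ_[p] := fun i => ⟨v i, h i⟩
    have e : v = ∑ i, z i • Pi.basisFun ℚ_[p] (Fin 2) i := by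
      ext j
      have e2 : ∀ i, (z i • Pi.basisFun ℚ_[p] (Fin 2) i) j
          = v i * (Pi.single i (1 : ℚ_[p]) : Fin 2 → ℚ_[p]) j := by
        intro i
        rw [Pi.basisFun_apply]
        rfl
      rw [Finset.sum_apply, Finset.sum_congr rfl fun i _ => e2 i]
      fin_cases j <;> simp [Fin.sum_univ_two]
    rw [e]
    exact sum_mem fun i _ => Submodule.smul_mem _ _ (Submodule.subset_span ⟨i, rfl⟩)

lemma single_mem_stdLat (j : Fin 2) : (Pi.single j 1 : Fin 2 → ℚ_[p]) ∈ (stdLat p).1 :=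
  mem_stdLat.2 fun i => by
    by_cases hij : i = j
    · subst hij; simp
    · simp [hij]

lemma mulVec_mem_stdLat {M : Matrix (Fin 2) (Fin 2) ℚ_[p]} (hM : ∀ i j, ‖M i j‖ ≤ 1)
    {v : Fin 2 → ℚ_[p]} (hv : v ∈ (stdLat p).1) : M *ᵥ v ∈ (stdLat p).1 := by
  rw [mem_stdLat] at hv ⊢
  intro i
  rw [mulVec, dotProduct, Fin.sum_univ_two]
  refine (Padic.nonarchimedean _ _).trans (max_le ?_ ?_)
  all_goals
    rw [norm_mul]
    exact mul_le_one₀ (hM _ _) (norm_nonneg _) (hv _)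

lemma norm_le_of_mulVec_mem {M : Matrix (Fin 2) (Fin 2) ℚ_[p]}
    (h : ∀ v ∈ (stdLat p).1, M *ᵥ v ∈ (stdLat p).1) (i j : Fin 2) : ‖M i j‖ ≤ 1 := by
  have := mem_stdLat.1 (h _ (single_mem_stdLat j)) i
  simpa using this

/-- The lattices strictly between `p L` and `L` for the standard lattice `L`. -/
def IsBetween (M : Submodule ℤ_[p] (Fin 2 → ℚ_[p])) : Prop :=
  (p : ℤ_[p]) • (stdLat p).1 < M ∧ M < (stdLat p).1

lemma p_smul_le (L : Submodule ℤ_[p] (Fin 2 → ℚ_[p])) : (p : ℤ_[p]) • L ≤ L := by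
  rintro _ ⟨v, hv, rfl⟩
  exact L.smul_mem _ hv

lemma p_smul_stdLat_lt : (p : ℤ_[p]) • (stdLat p).1 < (stdLat p).1 := by
  refine lt_of_le_of_ne (p_smul_le _) fun h => ?_
  have h1 := single_mem_stdLat (p := p) 0
  rw [← h] at h1
  obtain ⟨w, hw, e⟩ := h1
  have h2 : (p : ℚ_[p]) * w 0 = 1 := by
    have := congrFun e 0
    rwa [Pi.single_eq_same] at this
  have h3 : ‖(p : ℚ_[p]) * w 0‖ < 1 := by
    rw [norm_mul]
    exact (mul_le_of_le_one_right (norm_nonneg _) (mem_stdLat.1 hw 0)).trans_lt Padic.norm_p_lt_one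
  rw [h2, norm_one] at h3
  exact lt_irrefl _ h3

lemma smul_le_of_norm_lt {c : ℚ_[p]ˣ} (hc : ‖(c : ℚ_[p])‖ < 1)
    {M : Submodule ℤ_[p] (Fin 2 → ℚ_[p])} (hM : M ≤ (stdLat p).1) :
    c • M ≤ (p : ℤ_[p]) • (stdLat p).1 := by
  rintro _ ⟨v, hv, rfl⟩
  obtain ⟨b, hb⟩ := (PadicInt.norm_lt_one_iff_dvd ⟨(c : ℚ_[p]), hc.le⟩).1 hc
  refine ⟨b • v, Submodule.smul_mem _ _ (hM hv), ?_⟩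
  change (p : ℤ_[p]) • b • v = (c : ℚ_[p]) • v
  rw [smul_smul, ← hb]
  rfl

/-- Homothetic lattices between `p L` and `L` are equal. -/
lemma eq_of_homothetic {c : ℚ_[p]ˣ} {M : Submodule ℤ_[p] (Fin 2 → ℚ_[p])}
    (h1 : (p : ℤ_[p]) • (stdLat p).1 < M) (h2 : M ≤ (stdLat p).1)
    (h3 : (p : ℤ_[p]) • (stdLat p).1 < c • M) (h4 : c • M ≤ (stdLat p).1) : c • M = M := by
  -- A scalar of norm less than one would push `M` into `p L`. Applied to `c` and `c⁻¹`, this forces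
  -- `c` to be a `p`-adic unit.
  have aux : ∀ {c : ℚ_[p]ˣ} {M : Submodule ℤ_[p] (Fin 2 → ℚ_[p])}, M ≤ (stdLat p).1 →
      (p : ℤ_[p]) • (stdLat p).1 < c • M → 1 ≤ ‖(c : ℚ_[p])‖ := by
    intro c M h2 h3
    by_contra h
    exact not_le_of_gt h3 (smul_le_of_norm_lt (not_le.1 h) h2)
  have n1 := aux h2 h3
  have n2 := aux h4 (c := c⁻¹) (by rwa [inv_smul_smul])
  have n3 : ‖(c : ℚ_[p])‖ ≤ 1 := by
    rw [Units.val_inv_eq_inv_val, norm_inv] at n2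
    exact (one_le_inv₀ (by linarith)).1 n2
  have le : ∀ {c : ℚ_[p]ˣ} {M : Submodule ℤ_[p] (Fin 2 → ℚ_[p])}, ‖(c : ℚ_[p])‖ ≤ 1 → c • M ≤ M := by
    rintro c M h _ ⟨v, hv, rfl⟩
    exact M.smul_mem (⟨(c : ℚ_[p]), h⟩ : ℤ_[p]) hv
  refine le_antisymm (le n3) ?_
  have := le (c := c⁻¹) (M := c • M) (by
    rw [Units.val_inv_eq_inv_val, norm_inv]
    exact inv_le_one_of_one_le₀ n1)
  rwa [inv_smul_smul] at this

lemma unit_smul_lt {c : ℚ_[p]ˣ} {M N : Submodule ℤ_[p] (Fin 2 → ℚ_[p])} (h : M < N) :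
    c • M < c • N := by
  have mono : ∀ {c : ℚ_[p]ˣ} {M N : Submodule ℤ_[p] (Fin 2 → ℚ_[p])}, M ≤ N → c • M ≤ c • N := by
    rintro c M N h _ ⟨v, hv, rfl⟩
    exact ⟨v, h hv, rfl⟩
  refine lt_of_le_not_ge (mono h.le) fun h' => not_le_of_gt h ?_
  have := mono (c := c⁻¹) h'
  rwa [inv_smul_smul, inv_smul_smul] at this

/-- The number `p` as a unit of `ℚ_p`. -/
def pUnit (p : ℕ) [Fact p.Prime] : ℚ_[p]ˣ :=
  Units.mk0 (p : ℚ_[p]) (by exact_mod_cast (Fact.out : p.Prime).ne_zero)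

lemma pUnit_smul (M : Submodule ℤ_[p] (Fin 2 → ℚ_[p])) : pUnit p • M = (p : ℤ_[p]) • M := by
  ext v
  change (∃ w ∈ M, (p : ℚ_[p]) • w = v) ↔ ∃ w ∈ M, ((p : ℤ_[p]) : ℚ_[p]) • w = v
  simp

/-- The image of a lattice under a scalar. -/
def scaleLat (c : ℚ_[p]ˣ) (L : Lat p) : Lat p :=
  ⟨c • L.1, by have := L.2; infer_instance⟩

lemma mk_scaleLat (c : ℚ_[p]ˣ) (L : Lat p) :
    (Quotient.mk _ (scaleLat c L) : Vertex p) = Quotient.mk _ L :=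
  (Quotient.sound ⟨c, rfl⟩ : (Quotient.mk _ L : Vertex p) = Quotient.mk _ (scaleLat c L)).symm

/-- Neighbours of the base vertex are the classes of lattices strictly between `p L` and `L`. -/
lemma mem_neighborSet_iff {v : Vertex p} : v ∈ (tree p).neighborSet (baseVertex p) ↔
    ∃ M : Lat p, IsBetween M.1 ∧ Quotient.mk _ M = v := by
  rw [SimpleGraph.mem_neighborSet, tree, SimpleGraph.fromRel_adj]
  constructor
  · rintro ⟨-, ⟨L, M, hL, rfl, h1, h2⟩ | ⟨L, M, rfl, hM, h1, h2⟩⟩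
    · obtain ⟨c, hc⟩ := Quotient.exact hL
      have hc' : (stdLat p).1 = c • L.1 := hc
      refine ⟨scaleLat c M, ⟨?_, ?_⟩, mk_scaleLat c M⟩
      · rw [hc', ← pUnit_smul, smul_smul, mul_comm, ← smul_smul, pUnit_smul]
        exact unit_smul_lt h1
      · rw [hc']
        exact unit_smul_lt h2
    -- Here the base vertex is the class of the smaller lattice; multiplying the larger one by `p`
    -- places it between `p L` and `L`.
    · obtain ⟨c, hc⟩ := Quotient.exact hM
      have hc' : (stdLat p).1 = c • M.1 := hc
      refine ⟨scaleLat (pUnit p * c) L, ⟨?_, ?_⟩, mk_scaleLat _ L⟩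
      · change _ < (pUnit p * c) • L.1
        rw [hc', ← pUnit_smul, smul_smul]
        exact unit_smul_lt h2
      · change (pUnit p * c) • L.1 < _
        rw [hc', mul_comm, ← smul_smul, pUnit_smul]
        exact unit_smul_lt h1
  · rintro ⟨M, hM, rfl⟩
    refine ⟨fun h => ?_, Or.inl ⟨stdLat p, M, rfl, rfl, hM.1, hM.2⟩⟩
    obtain ⟨c, hc⟩ := Quotient.exact h
    have hc' : M.1 = c • (stdLat p).1 := hc
    refine hM.2.ne ?_
    rw [hc']
    exact eq_of_homothetic p_smul_stdLat_lt le_rfl (hc' ▸ hM.1) (hc' ▸ hM.2.le)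

lemma IsBetween.eq_of_mk_eq {M N : Lat p} (hM : IsBetween M.1) (hN : IsBetween N.1)
    (h : (Quotient.mk _ M : Vertex p) = Quotient.mk _ N) : M = N := by
  obtain ⟨c, hc⟩ := Quotient.exact h
  have hc' : N.1 = c • M.1 := hc
  refine Subtype.ext ?_
  rw [hc']
  exact (eq_of_homothetic hM.1 hM.2.le (hc' ▸ hN.1) (hc' ▸ hN.2.le)).symm

/-! ### Action of the elements of norm `p` on the neighbours -/

variable (φ : LocalSplitting p)

lemma LocalSplitting.mem_hurwitz_of_mulVec {x : ℍ[ℚ]} (hpx : (p : ℍ[ℚ]) * x ∈ hurwitz)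
    (h : ∀ v ∈ (stdLat p).1, φ.hom x *ᵥ v ∈ (stdLat p).1) : x ∈ hurwitz :=
  φ.mem_hurwitz hpx (norm_le_of_mulVec_mem h)

lemma LocalSplitting.hom_mulVec_mem {x : ℍ[ℚ]} (hx : x ∈ hurwitz) {v : Fin 2 → ℚ_[p]}
    (hv : v ∈ (stdLat p).1) : φ.hom x *ᵥ v ∈ (stdLat p).1 :=
  mulVec_mem_stdLat (φ.norm_hom_le hx) hv

lemma LocalSplitting.hom_natCast_mulVec (n : ℕ) (v : Fin 2 → ℚ_[p]) :
    φ.hom (n : ℍ[ℚ]) *ᵥ v = (n : ℚ_[p]) • v := by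
  rw [map_natCast, natCast_mulVec]

variable {S : Finset Nat.Primes}

lemma mem_glLat {g : Gam S} {L : Lat p} {v : Fin 2 → ℚ_[p]} :
    v ∈ (glLat (φ.toGL S g) L).1 ↔ ∃ w ∈ L.1, φ.hom (quat g) *ᵥ w = v := Iff.rfl

/-- An element of norm `p` moves the base vertex to a neighbour. -/
lemma isBetween_glLat {g : Gam S} (hg : g ∈ normSet S p) :
    IsBetween (glLat (φ.toGL S g) (stdLat p)).1 := by
  have hp0 : (p : ℚ) ≠ 0 := by exact_mod_cast (Fact.out : p.Prime).ne_zero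
  have hp1 : ∀ n : ℕ, (p : ℚ) * n ≠ 1 := by
    intro n h
    have h' : p * n = 1 := by exact_mod_cast h
    exact (Fact.out : p.Prime).one_lt.ne' (Nat.dvd_one.1 ⟨n, h'.symm⟩)
  refine ⟨lt_of_le_of_ne ?_ fun h => ?_, lt_of_le_of_ne ?_ fun h => ?_⟩
  · rintro _ ⟨v, hv, rfl⟩
    refine (mem_glLat φ).2
      ⟨φ.hom (star (quat g)) *ᵥ v, φ.hom_mulVec_mem (star_mem_hurwitz hg.1) hv, ?_⟩
    rw [mulVec_mulVec, ← map_mul, mul_star_eq hg.2, φ.hom_natCast_mulVec]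
    rfl
  -- If `g L = p L`, then `g / p` preserves `L` and lies in the order, although its norm is `1 / p`.
  -- In the other equality case, `g L = L`, the same holds for `g⁻¹`.
  · have hx : ((p : ℚ)⁻¹ • quat g) ∈ hurwitz := by
      have e : (p : ℍ[ℚ]) * ((p : ℚ)⁻¹ • quat g) = quat g := by
        rw [mul_smul_comm, ← nsmul_eq_mul, ← Nat.cast_smul_eq_nsmul ℚ, smul_smul,
          inv_mul_cancel₀ hp0, one_smul]
      refine φ.mem_hurwitz_of_mulVec (by rw [e]; exact hg.1) fun v hv => ?_
      have hv' : φ.hom (quat g) *ᵥ v ∈ (glLat (φ.toGL S g) (stdLat p)).1 :=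
        (mem_glLat φ).2 ⟨v, hv, rfl⟩
      rw [← h] at hv'
      obtain ⟨w, hw, ew⟩ := hv'
      have ew' : (p : ℚ_[p]) • w = φ.hom (quat g) *ᵥ v := ew
      have : φ.hom ((p : ℚ)⁻¹ • quat g) *ᵥ v = w := by
        have hp0' : (p : ℚ_[p]) ≠ 0 := by exact_mod_cast (Fact.out : p.Prime).ne_zero
        refine smul_right_injective _ hp0' ?_
        change (p : ℚ_[p]) • _ = (p : ℚ_[p]) • w
        rw [ew', ← φ.hom_natCast_mulVec, mulVec_mulVec, ← map_mul, e]
      rwa [this]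
    obtain ⟨n, hn⟩ := exists_normSq_eq hx
    rw [normSq_smul, hg.2] at hn
    refine hp1 n ?_
    rw [← hn]
    field_simp
  · rintro _ ⟨v, hv, rfl⟩
    exact φ.hom_mulVec_mem hg.1 hv
  · have hx : quat g⁻¹ ∈ hurwitz := by
      refine φ.mem_hurwitz_of_mulVec ?_ fun v hv => ?_
      · rw [← star_mul_eq hg.2, mul_assoc, quat_mul_quat_inv, mul_one]
        exact star_mem_hurwitz hg.1
      · rw [← h] at hv
        obtain ⟨w, hw, rfl⟩ := (mem_glLat φ).1 hv
        rw [mulVec_mulVec, ← map_mul, quat_inv, inv_mul_cancel₀ (quat_ne_zero g), map_one,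
          one_mulVec]
        exact hw
    obtain ⟨n, hn⟩ := exists_normSq_eq hx
    refine hp1 n ?_
    rw [← hn, ← hg.2, ← map_mul, quat_mul_quat_inv, map_one]

lemma glVertex_mem_neighborSet {g : Gam S} (hg : g ∈ normSet S p) :
    glVertex (φ.toGL S g) (baseVertex p) ∈ (tree p).neighborSet (baseVertex p) :=
  mem_neighborSet_iff.2 ⟨_, isBetween_glLat φ hg, rfl⟩

lemma LocalSplitting.hom_algebraMap_mulVec (c : ℚ) (v : Fin 2 → ℚ_[p]) :
    φ.hom (algebraMap ℚ ℍ[ℚ] c) *ᵥ v = (c : ℚ_[p]) • v := by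
  have h : φ.hom.comp (algebraMap ℚ ℍ[ℚ])
      = (algebraMap ℚ_[p] (Matrix (Fin 2) (Fin 2) ℚ_[p])).comp (algebraMap ℚ ℚ_[p]) :=
    Subsingleton.elim _ _
  have h2 : φ.hom (algebraMap ℚ ℍ[ℚ] c) = algebraMap ℚ_[p] _ (c : ℚ_[p]) := RingHom.congr_fun h c
  rw [h2, Algebra.algebraMap_eq_smul_one, smul_mulVec, one_mulVec]

lemma glVertex_congr {g h : Gam S} (e : bar g = bar h) :
    glVertex (φ.toGL S g) (baseVertex p) = glVertex (φ.toGL S h) (baseVertex p) := by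
  obtain ⟨c, hc⟩ := bar_eq_iff.1 e
  have hc0 : c ≠ 0 := by
    rintro rfl
    rw [map_zero, mul_zero] at hc
    exact quat_ne_zero h hc
  have hc0' : (c : ℚ_[p]) ≠ 0 := by exact_mod_cast hc0
  have key : ∀ w, φ.hom (quat h) *ᵥ w = (c : ℚ_[p]) • (φ.hom (quat g) *ᵥ w) := by
    intro w
    rw [hc, map_mul, ← mulVec_mulVec, φ.hom_algebraMap_mulVec, mulVec_smul]
  refine Quotient.sound ⟨Units.mk0 _ hc0', ?_⟩
  ext v
  constructor
  · rintro ⟨w, hw, rfl⟩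
    exact ⟨φ.hom (quat g) *ᵥ w, ⟨w, hw, rfl⟩, (key w).symm⟩
  · rintro ⟨_, ⟨w, hw, rfl⟩, rfl⟩
    exact ⟨w, hw, key w⟩

lemma glVertex_mul_unit (g : Gam S) {w : Gam S} (hw : quat w ∈ hurwitz)
    (hN : normSq (quat w) = 1) :
    glVertex (φ.toGL S (g * w)) (baseVertex p) = glVertex (φ.toGL S g) (baseVertex p) := by
  have hN' : normSq (quat w) = (1 : ℕ) := by simpa using hN
  refine congrArg (Quotient.mk _) (Subtype.ext (SetLike.ext fun v => ?_))
  constructor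
  · rintro ⟨x, hx, rfl⟩
    refine (mem_glLat φ).2 ⟨φ.hom (quat w) *ᵥ x, φ.hom_mulVec_mem hw hx, ?_⟩
    rw [mulVec_mulVec, ← map_mul]
    rfl
  · intro hv
    obtain ⟨x, hx, rfl⟩ := (mem_glLat φ).1 hv
    refine (mem_glLat φ).2 ⟨φ.hom (star (quat w)) *ᵥ x,
      φ.hom_mulVec_mem (star_mem_hurwitz hw) hx, ?_⟩
    rw [mulVec_mulVec, ← map_mul, quat_mul, mul_assoc, mul_star_eq hN', Nat.cast_one, mul_one]

/-- Elements of norm `p` move the base vertex to the same neighbour exactly if they lie in the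
same orbit under right multiplication by units. -/
lemma glVertex_eq_iff {g h : Gam S} (hg : g ∈ normSet S p) (hh : h ∈ normSet S p) :
    glVertex (φ.toGL S g) (baseVertex p) = glVertex (φ.toGL S h) (baseVertex p) ↔
      ∃ u ∈ unitsBar S, bar h = bar g * u := by
  constructor
  · intro e
    have e' := congrArg Subtype.val
      (IsBetween.eq_of_mk_eq (isBetween_glLat φ hg) (isBetween_glLat φ hh) e)
    refine ⟨bar (g⁻¹ * h), mem_unitsBar_iff.2 ⟨g⁻¹ * h, ?_, ?_, rfl⟩, by
      rw [← map_mul, mul_inv_cancel_left]⟩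
    -- Equal vertices mean equal lattices `g L = h L`, so `g⁻¹ h` preserves `L`; and `p g⁻¹ h = star
    -- g * h` lies in the order.
    · refine φ.mem_hurwitz_of_mulVec ?_ fun v hv => ?_
      · rw [quat_mul, ← star_mul_eq hg.2, mul_assoc, ← mul_assoc (quat g), quat_mul_quat_inv,
          one_mul]
        exact mul_mem (star_mem_hurwitz hg.1) hh.1
      · have hv' : φ.hom (quat h) *ᵥ v ∈ (glLat (φ.toGL S h) (stdLat p)).1 :=
          (mem_glLat φ).2 ⟨v, hv, rfl⟩
        rw [← e'] at hv'
        obtain ⟨w, hw, ew⟩ := (mem_glLat φ).1 hv'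
        rw [quat_mul, map_mul, ← mulVec_mulVec, ← ew, mulVec_mulVec, ← map_mul, quat_inv,
          inv_mul_cancel₀ (quat_ne_zero g), map_one, one_mulVec]
        exact hw
    · have hp0 : (p : ℚ) ≠ 0 := by exact_mod_cast (Fact.out : p.Prime).ne_zero
      rw [quat_mul, quat_inv, map_mul, map_inv₀, hg.2, hh.2, inv_mul_cancel₀ hp0]
  · rintro ⟨u, hu, e⟩
    obtain ⟨w, hwO, hwN, rfl⟩ := mem_unitsBar_iff.1 hu
    rw [← map_mul] at e
    rw [glVertex_congr φ e, glVertex_mul_unit φ g hwO hwN]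

/-- Every lattice strictly between `p L` and `L` is the image of `L` under an element of
norm `p`. -/
lemma exists_hom_image_eq {M : Submodule ℤ_[p] (Fin 2 → ℚ_[p])} (hM : IsBetween M) :
    ∃ d ∈ hurwitz, normSq d = p ∧ ∀ v, v ∈ M ↔ ∃ w ∈ (stdLat p).1, φ.hom d *ᵥ w = v := by
  have hp : p.Prime := Fact.out
  have hpM : ∀ v ∈ (stdLat p).1, (p : ℚ_[p]) • v ∈ M := fun v hv => hM.1.le ⟨v, hv, rfl⟩
  -- The right ideal of all `z` with `z L ⊆ M`; its generator will satisfy `d L = M`.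
  let I : AddSubgroup ℍ[ℚ] :=
    { carrier := {z | z ∈ hurwitz ∧ ∀ v ∈ (stdLat p).1, φ.hom z *ᵥ v ∈ M}
      add_mem' := by
        rintro x y ⟨hx, hx'⟩ ⟨hy, hy'⟩
        exact ⟨add_mem hx hy, fun v hv => by
          rw [map_add, add_mulVec]; exact add_mem (hx' v hv) (hy' v hv)⟩
      zero_mem' := ⟨zero_mem _, fun v _ => by rw [map_zero, zero_mulVec]; exact zero_mem _⟩
      neg_mem' := by
        rintro x ⟨hx, hx'⟩
        exact ⟨neg_mem hx, fun v hv => by rw [map_neg, neg_mulVec]; exact neg_mem (hx' v hv)⟩ }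
  obtain ⟨d, ⟨hdO, hdM⟩, hd⟩ := exists_generator I (fun x hx => hx.1) (by
    rintro x ⟨hx, hx'⟩ y hy
    exact ⟨mul_mem hx hy, fun v hv => by
      rw [map_mul, ← mulVec_mulVec]; exact hx' _ (φ.hom_mulVec_mem hy hv)⟩)
  obtain ⟨z, hz, hpz⟩ := hd p ⟨natCast_mem _ p, fun v hv => by
    rw [φ.hom_natCast_mulVec]; exact hpM v hv⟩
  have himg : ∀ v, v ∈ M ↔ ∃ w ∈ (stdLat p).1, φ.hom d *ᵥ w = v := by
    intro m
    refine ⟨fun hm => ?_, by rintro ⟨w, hw, rfl⟩; exact hdM w hw⟩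
    have hmL := mem_stdLat.1 (hM.2.le hm)
    -- The matrix with first column `m` and second column zero maps `L` into `M`. Its approximation
    -- `y` differs by `p` times an integral matrix, so `y` is in the ideal, and `m = y e₀ + p (B
    -- e₀)` lies in `d L` because `d` left-divides both `y` and `p`.
    obtain ⟨y, hy, B, hB, e⟩ := φ.exists_eq_add
      (M := Matrix.of fun i j => if j = 0 then m i else 0) (by
        intro i j
        rw [Matrix.of_apply]
        split_ifs
        · exact hmL i
        · simp)
    have e' : ∀ v, φ.hom y *ᵥ v = v 0 • m - (p : ℚ_[p]) • (B *ᵥ v) := by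
      intro v
      rw [eq_sub_iff_add_eq, ← smul_mulVec, ← add_mulVec, ← e]
      ext i
      simp [mulVec, dotProduct, mul_comm]
    obtain ⟨x, hx, rfl⟩ := hd y ⟨hy, fun v hv => by
      rw [e']
      exact sub_mem (M.smul_mem (⟨v 0, mem_stdLat.1 hv 0⟩ : ℤ_[p]) hm)
        (hpM _ (mulVec_mem_stdLat hB hv))⟩
    have h1 := single_mem_stdLat (p := p) 0
    have e1 := e' (Pi.single 0 1)
    rw [Pi.single_eq_same, one_smul, eq_sub_iff_add_eq, ← φ.hom_natCast_mulVec, hpz, map_mul,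
      map_mul, ← mulVec_mulVec, ← mulVec_mulVec, ← mulVec_add] at e1
    exact ⟨_, add_mem (φ.hom_mulVec_mem hx h1) (φ.hom_mulVec_mem hz (mulVec_mem_stdLat hB h1)), e1⟩
  obtain ⟨n, hn⟩ := exists_normSq_eq hdO
  obtain ⟨m, hm⟩ := exists_normSq_eq hz
  have hnm : n * m = p ^ 2 := by
    have := congrArg normSq hpz
    rw [map_mul, hn, hm, normSq_natCast] at this
    exact_mod_cast this.symm
  refine ⟨d, hdO, ?_, himg⟩
  obtain ⟨i, hi, rfl⟩ := (Nat.dvd_prime_pow hp).1 ⟨m, hnm.symm⟩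
  -- Norm `1` would give `M = L` and norm `p ^ 2` would give `M = p L`, both excluded by strictness.
  interval_cases i
  · exfalso
    refine not_le_of_gt hM.2 fun v hv => (himg v).2
      ⟨φ.hom (star d) *ᵥ v, φ.hom_mulVec_mem (star_mem_hurwitz hdO) hv, ?_⟩
    rw [mulVec_mulVec, ← map_mul, mul_star_eq (n := 1) (by simpa using hn), Nat.cast_one, map_one,
      one_mulVec]
  · simpa using hn
  · exfalso
    have hm1 : normSq z = (1 : ℕ) := by
      rw [hm]
      have : p ^ 2 * m = p ^ 2 * 1 := by rw [hnm, mul_one]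
      exact_mod_cast Nat.eq_of_mul_eq_mul_left (pow_pos hp.pos 2) this
    refine not_le_of_gt hM.1 fun v hv => ?_
    obtain ⟨w, hw, rfl⟩ := (himg v).1 hv
    refine ⟨φ.hom (star z) *ᵥ w, φ.hom_mulVec_mem (star_mem_hurwitz hz) hw, ?_⟩
    change (p : ℚ_[p]) • (φ.hom (star z) *ᵥ w) = _
    rw [← φ.hom_natCast_mulVec, mulVec_mulVec, ← map_mul, hpz, mul_assoc, mul_star_eq hm1,
      Nat.cast_one, mul_one]

end Lattices

/-! ### The number of neighbours -/

section Count

variable {p : ℕ} [Fact p.Prime]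

/-- The lattice of integral vectors whose reduction modulo `p` lies in a given subspace. -/
def liftSubspace (N : Submodule (ZMod p) (Fin 2 → ZMod p)) : Submodule ℤ_[p] (Fin 2 → ℚ_[p]) where
  carrier := {v | ∃ w : Fin 2 → ℤ_[p], (fun i => (w i : ℚ_[p])) = v ∧
    (fun i => PadicInt.toZMod (w i)) ∈ N}
  add_mem' := by
    rintro _ _ ⟨w, rfl, hw⟩ ⟨w', rfl, hw'⟩
    refine ⟨w + w', by ext i; simp, ?_⟩
    convert N.add_mem hw hw' using 1
    ext i; simp
  zero_mem' := ⟨0, by ext i; simp, by convert N.zero_mem using 1; ext i; simp⟩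
  smul_mem' := by
    rintro a _ ⟨w, rfl, hw⟩
    refine ⟨a • w, by ext i; simp [Algebra.smul_def], ?_⟩
    convert N.smul_mem (PadicInt.toZMod a) hw using 1
    ext i; simp

/-- The reduction modulo `p` of the integral vectors in a module. -/
def reduceLattice (M : Submodule ℤ_[p] (Fin 2 → ℚ_[p])) :
    Submodule (ZMod p) (Fin 2 → ZMod p) where
  carrier := {x | ∃ w : Fin 2 → ℤ_[p], (fun i => (w i : ℚ_[p])) ∈ M ∧
    (fun i => PadicInt.toZMod (w i)) = x}
  add_mem' := by
    rintro _ _ ⟨w, hw, rfl⟩ ⟨w', hw', rfl⟩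
    refine ⟨w + w', ?_, by ext i; simp⟩
    convert M.add_mem hw hw' using 1
    ext i; simp
  zero_mem' := ⟨0, by convert M.zero_mem using 1; ext i; simp, by ext i; simp⟩
  smul_mem' := by
    rintro a _ ⟨w, hw, rfl⟩
    obtain ⟨b, rfl⟩ := ZMod.ringHom_surjective PadicInt.toZMod a
    refine ⟨b • w, ?_, by ext i; simp⟩
    convert M.smul_mem b hw using 1
    ext i; simp [Algebra.smul_def]

lemma exists_lift (x : Fin 2 → ZMod p) :
    ∃ w : Fin 2 → ℤ_[p], (fun i => PadicInt.toZMod (w i)) = x := by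
  choose w hw using fun i => ZMod.ringHom_surjective (PadicInt.toZMod (p := p)) (x i)
  exact ⟨w, funext hw⟩

lemma coe_mem_stdLat (w : Fin 2 → ℤ_[p]) : (fun i => (w i : ℚ_[p])) ∈ (stdLat p).1 :=
  mem_stdLat.2 fun i => (w i).2

lemma exists_coe_eq {v : Fin 2 → ℚ_[p]} (hv : v ∈ (stdLat p).1) :
    ∃ w : Fin 2 → ℤ_[p], (fun i => (w i : ℚ_[p])) = v :=
  ⟨fun i => ⟨v i, mem_stdLat.1 hv i⟩, rfl⟩

lemma coe_injective {w w' : Fin 2 → ℤ_[p]}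
    (h : (fun i => (w i : ℚ_[p])) = fun i => (w' i : ℚ_[p])) : w = w' :=
  funext fun i => Subtype.ext (congrFun h i)

lemma coe_mem_p_smul_iff {w : Fin 2 → ℤ_[p]} :
    (fun i => (w i : ℚ_[p])) ∈ (p : ℤ_[p]) • (stdLat p).1 ↔
      (fun i => PadicInt.toZMod (w i)) = 0 := by
  have hz : ∀ a : ℤ_[p], PadicInt.toZMod a = 0 ↔ (p : ℤ_[p]) ∣ a := by
    intro a
    rw [← RingHom.mem_ker, PadicInt.ker_toZMod, PadicInt.maximalIdeal_eq_span_p,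
      Ideal.mem_span_singleton]
  constructor
  · rintro ⟨v, hv, e⟩
    obtain ⟨w', rfl⟩ := exists_coe_eq hv
    have : w = fun i => (p : ℤ_[p]) * w' i := coe_injective (by
      rw [← e]
      ext i
      rw [PadicInt.coe_mul]
      rfl)
    rw [this]
    ext i
    exact (hz _).2 (dvd_mul_right _ _)
  · intro h
    choose w' hw' using fun i => (hz (w i)).1 (congrFun h i)
    refine ⟨_, coe_mem_stdLat w', ?_⟩
    ext i
    rw [hw' i, PadicInt.coe_mul]
    rfl

lemma coe_mem_liftSubspace_iff {N : Submodule (ZMod p) (Fin 2 → ZMod p)} {w : Fin 2 → ℤ_[p]} :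
    (fun i => (w i : ℚ_[p])) ∈ liftSubspace N ↔ (fun i => PadicInt.toZMod (w i)) ∈ N := by
  constructor
  · rintro ⟨w', e, h⟩
    rwa [← coe_injective e]
  · exact fun h => ⟨w, rfl, h⟩

lemma liftSubspace_le (N : Submodule (ZMod p) (Fin 2 → ZMod p)) :
    liftSubspace N ≤ (stdLat p).1 := by
  rintro _ ⟨w, rfl, -⟩
  exact coe_mem_stdLat w

lemma le_liftSubspace (N : Submodule (ZMod p) (Fin 2 → ZMod p)) :
    (p : ℤ_[p]) • (stdLat p).1 ≤ liftSubspace N := by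
  intro v hv
  obtain ⟨w, rfl⟩ := exists_coe_eq (p_smul_le _ hv)
  rw [coe_mem_liftSubspace_iff, coe_mem_p_smul_iff.1 hv]
  exact N.zero_mem

lemma isBetween_liftSubspace {N : Submodule (ZMod p) (Fin 2 → ZMod p)}
    (hN : Module.finrank (ZMod p) N = 1) : IsBetween (liftSubspace N) := by
  refine ⟨lt_of_le_of_ne (le_liftSubspace N) fun h => ?_,
    lt_of_le_of_ne (liftSubspace_le N) fun h => ?_⟩
  · have : N = ⊥ := by
      refine eq_bot_iff.2 fun x hx => ?_
      obtain ⟨w, rfl⟩ := exists_lift x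
      rw [← coe_mem_liftSubspace_iff, ← h, coe_mem_p_smul_iff] at hx
      exact hx
    rw [this, finrank_bot] at hN
    omega
  · have : N = ⊤ := by
      refine eq_top_iff.2 fun x _ => ?_
      obtain ⟨w, rfl⟩ := exists_lift x
      rw [← coe_mem_liftSubspace_iff, h]
      exact coe_mem_stdLat w
    rw [this, finrank_top, Module.finrank_fin_fun] at hN
    omega

/-- Since `M` contains `p L`, it is a union of cosets of `p L` and is recovered from its reduction.
-/
lemma IsBetween.liftSubspace_reduceLattice {M : Submodule ℤ_[p] (Fin 2 → ℚ_[p])}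
    (hM : IsBetween M) : liftSubspace (reduceLattice M) = M := by
  ext v
  constructor
  · rintro ⟨w, rfl, w', hw', e⟩
    have h : (fun i => ((w - w') i : ℚ_[p])) ∈ (p : ℤ_[p]) • (stdLat p).1 := by
      rw [coe_mem_p_smul_iff]
      ext i
      have := congrFun e i
      simp [this]
    have h2 := M.add_mem (hM.1.le h) hw'
    convert h2 using 1
    ext i
    simp
  · intro hv
    obtain ⟨w, rfl⟩ := exists_coe_eq (hM.2.le hv)
    exact ⟨w, rfl, w, hv, rfl⟩

lemma IsBetween.finrank_reduceLattice {M : Submodule ℤ_[p] (Fin 2 → ℚ_[p])} (hM : IsBetween M) :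
    Module.finrank (ZMod p) (reduceLattice M) = 1 := by
  have hbot : reduceLattice M ≠ ⊥ := fun h => by
    refine not_le_of_gt hM.1 fun v hv => ?_
    obtain ⟨w, rfl⟩ := exists_coe_eq (hM.2.le hv)
    rw [coe_mem_p_smul_iff, ← Submodule.mem_bot (ZMod p), ← h]
    exact ⟨w, hv, rfl⟩
  have htop : reduceLattice M ≠ ⊤ := fun h => by
    refine not_le_of_gt hM.2 fun v hv => ?_
    obtain ⟨w, rfl⟩ := exists_coe_eq hv
    rw [← hM.liftSubspace_reduceLattice, coe_mem_liftSubspace_iff, h]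
    trivial
  have h1 : Module.finrank (ZMod p) (reduceLattice M) ≠ 0 := fun h =>
    hbot (Submodule.finrank_eq_zero.1 h)
  have h2 := Submodule.finrank_lt (lt_top_iff_ne_top.2 htop).ne
  rw [Module.finrank_fin_fun] at h2
  omega

/-- `M` contains the spanning lattice `p L`, and is finitely generated inside `L` because `ℤ_p` is
Noetherian. -/
lemma IsBetween.isLattice {M : Submodule ℤ_[p] (Fin 2 → ℚ_[p])} (hM : IsBetween M) :
    Submodule.IsLattice ℚ_[p] M := by
  have h1 : Submodule.IsLattice ℚ_[p] ((p : ℤ_[p]) • (stdLat p).1) := by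
    rw [← pUnit_smul]
    exact (scaleLat (pUnit p) (stdLat p)).2
  refine Submodule.IsLattice.of_le_of_isLattice_of_fg ℚ_[p] hM.1.le ?_
  have : IsNoetherian ℤ_[p] (stdLat p).1 := isNoetherian_of_fg_of_noetherian _ (stdLat p).2.fg
  have h2 : IsNoetherian ℤ_[p] M := isNoetherian_of_le hM.2.le
  exact Module.Finite.iff_fg.1 inferInstance

/-- The base vertex has `p + 1` neighbours. -/
theorem ncard_neighborSet : ((tree p).neighborSet (baseVertex p)).ncard = p + 1 := by
  let F : {N : Submodule (ZMod p) (Fin 2 → ZMod p) // Module.finrank (ZMod p) N = 1} →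
      (tree p).neighborSet (baseVertex p) := fun N =>
    ⟨Quotient.mk _ ⟨liftSubspace N.1, (isBetween_liftSubspace N.2).isLattice⟩,
      mem_neighborSet_iff.2 ⟨_, isBetween_liftSubspace N.2, rfl⟩⟩
  have hF : Function.Bijective F := by
    constructor
    · intro N N' h
      have h2 := congrArg Subtype.val (IsBetween.eq_of_mk_eq (isBetween_liftSubspace N.2)
        (isBetween_liftSubspace N'.2) (congrArg Subtype.val h))
      have h3 : liftSubspace N.1 = liftSubspace N'.1 := h2
      refine Subtype.ext (SetLike.ext fun x => ?_)
      obtain ⟨w, rfl⟩ := exists_lift x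
      rw [← coe_mem_liftSubspace_iff, h3, coe_mem_liftSubspace_iff]
    · rintro ⟨v, hv⟩
      obtain ⟨M, hM, rfl⟩ := mem_neighborSet_iff.1 hv
      refine ⟨⟨reduceLattice M.1, hM.finrank_reduceLattice⟩, Subtype.ext ?_⟩
      exact congrArg (Quotient.mk _) (Subtype.ext hM.liftSubspace_reduceLattice)
  have h1 := Nat.card_congr (Equiv.ofBijective F hF)
  rw [← Nat.card_congr (Projectivization.equivSubmodule (ZMod p) (Fin 2 → ZMod p)),
    Projectivization.card_of_finrank_two _ _ (Module.finrank_fin_fun _), Nat.card_zmod] at h1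
  exact h1.symm

end Count

/-! ### Systems of representatives -/

section Systems

variable {S : Finset Nat.Primes} {p : S} (φ : LocalSplitting (p : Nat.Primes))

/-- Translates the geometric uniqueness condition at a neighbour into the one at the corresponding
right orbit. -/
lemma moves_iff {g : Gam S} (hg : g ∈ normSet S (p : Nat.Primes)) {x : GamBar S} :
    Moves φ x (glVertex (φ.toGL S g) (baseVertex (p : Nat.Primes))) ↔
      ∃ u ∈ unitsBar S, x = bar g * u := by
  constructor
  · rintro ⟨h, hh, rfl, e⟩
    exact (glVertex_eq_iff φ hg hh).1 e.symm
  · rintro ⟨u, hu, rfl⟩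
    obtain ⟨w, hwO, hwN, rfl⟩ := mem_unitsBar_iff.1 hu
    exact ⟨g * w, mul_mem_normSet hg hwO hwN, map_mul _ _ _, glVertex_mul_unit φ g hwO hwN⟩

lemma exists_glVertex_eq {v : Vertex (p : Nat.Primes)}
    (hv : v ∈ (tree (p : Nat.Primes)).neighborSet (baseVertex (p : Nat.Primes))) :
    ∃ g ∈ normSet S (p : Nat.Primes), glVertex (φ.toGL S g) (baseVertex (p : Nat.Primes)) = v := by
  obtain ⟨M, hM, rfl⟩ := mem_neighborSet_iff.1 hv
  obtain ⟨d, hd, hdp, h⟩ := exists_hom_image_eq φ hM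
  obtain ⟨g, hg, rfl⟩ := exists_mem_normSet hd p.2 hdp
  refine ⟨g, hg, congrArg (Quotient.mk _) (Subtype.ext (SetLike.ext fun v => ?_))⟩
  rw [h]
  exact mem_glLat φ

/-- Choosing by neighbours is choosing by right orbits. -/
theorem isNeighbourSystem_iff {B : Set (GamBar S)} :
    IsNeighbourSystem φ B ↔ IsRightOrbitSystem ((p : Nat.Primes) : ℕ) B := by
  constructor
  · rintro ⟨h1, h2⟩
    refine ⟨fun x hx => ?_, fun g hg => ?_⟩
    · obtain ⟨v, -, g, hg, e, -⟩ := h1 x hx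
      exact ⟨g, hg, e⟩
    · have := h2 _ (glVertex_mem_neighborSet φ hg)
      simpa only [moves_iff φ hg] using this
  · rintro ⟨h1, h2⟩
    refine ⟨fun x hx => ?_, fun v hv => ?_⟩
    · obtain ⟨g, hg, rfl⟩ := h1 hx
      exact ⟨_, glVertex_mem_neighborSet φ hg, g, hg, rfl, rfl⟩
    · obtain ⟨g, hg, rfl⟩ := exists_glVertex_eq φ hv
      simpa only [moves_iff φ hg] using h2 g hg

theorem IsNeighbourSystem.ncard_eq {B : Set (GamBar S)} (hB : IsNeighbourSystem φ B) :
    B.ncard = ((p : Nat.Primes) : ℕ) + 1 := by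
  rw [← ncard_neighborSet (p := ((p : Nat.Primes) : ℕ))]
  choose! f hf hf' using hB.2
  -- A class determines the neighbour it reaches, whichever representative is used, so choosing a
  -- representative for each neighbour is a bijection.
  refine (Set.ncard_congr (fun v _ => f v) (fun v hv => (hf v hv).1) ?_ ?_).symm
  · intro v w hv hw e
    obtain ⟨g, -, hg, rfl⟩ := (hf v hv).2
    obtain ⟨h, -, hh, rfl⟩ := (hf w hw).2
    refine glVertex_congr φ ?_
    rw [hg, hh]
    exact e
  · intro x hx
    obtain ⟨v, hv, hm⟩ := hB.1 x hx
    exact ⟨v, hv, (hf' v hv x ⟨hx, hm⟩).symm⟩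

/-- There are finitely many neighbours, and the classes reaching a given one form a single orbit of
the finite group `Ō^*`. Hall's theorem needs this finiteness. -/
lemma finite_normBar (φ : LocalSplitting (p : Nat.Primes)) :
    (normBar S ((p : Nat.Primes) : ℕ)).Finite := by
  have hfin : ((tree (p : Nat.Primes)).neighborSet (baseVertex (p : Nat.Primes))).Finite :=
    Set.finite_of_ncard_pos (by rw [ncard_neighborSet]; omega)
  choose! r hr hr' using fun v hv => exists_glVertex_eq φ (v := v) hv
  have hU : (unitsBar S : Set (GamBar S)).Finite :=
    Set.finite_coe_iff.1 (finite_unitsBar S)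
  refine ((hfin.prod hU).image fun x => bar (r x.1) * x.2).subset ?_
  rintro _ ⟨g, hg, rfl⟩
  have hv := glVertex_mem_neighborSet φ hg
  obtain ⟨u, hu, e⟩ := (glVertex_eq_iff φ (hr _ hv) hg).1 (hr' _ hv)
  exact ⟨(_, u), ⟨hv, hu⟩, e.symm⟩

theorem exists_two_sided_system : ∃ A : Set (GamBar S), IsNeighbourSystem φ A ∧
    IsLeftOrbitSystem ((p : Nat.Primes) : ℕ) A := by
  obtain ⟨A, hA, h1, h2⟩ := exists_two_sided_representatives (unitsBar S) (finite_normBar φ)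
    (fun x hx u hu => unit_mul_mem_normBar hx hu) (fun x hx u hu => mul_unit_mem_normBar hx hu)
  exact ⟨A, (isNeighbourSystem_iff φ).2 ⟨hA, fun g hg => h1 _ ⟨g, hg, rfl⟩⟩,
    hA, fun g hg => h2 _ ⟨g, hg, rfl⟩⟩

end Systems

end SUnit
end

/-! ### The main theorem -/

open SUnit in
theorem mainTheorem3 (S : Finset Nat.Primes) (hS : ∀ p ∈ S, Odd (p : ℕ))
    (φ : ∀ p : S, LocalSplitting (p : Nat.Primes)) :
    -- `Ō^*` is isomorphic to `A₄`, so that `A₀` has 11 elements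
    Nonempty (unitsBar S ≃* alternatingGroup (Fin 4)) ∧ (A0 S).ncard = 11 ∧
    -- choosing by neighbours of `v_{0,p}` is choosing by orbits, and takes `p + 1` elements
    (∀ (p : S) (B : Set (GamBar S)),
      (IsNeighbourSystem (φ p) B ↔ IsRightOrbitSystem ((p : Nat.Primes) : ℕ) B) ∧
      (IsNeighbourSystem (φ p) B → B.ncard = ((p : Nat.Primes) : ℕ) + 1)) ∧
    -- there is a choice that also represents the left orbits
    (∃ A : S → Set (GamBar S), ∀ p : S, IsNeighbourSystem (φ p) (A p) ∧
      IsLeftOrbitSystem ((p : Nat.Primes) : ℕ) (A p)) ∧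
    ∀ A : S → Set (GamBar S), (∀ p : S, IsNeighbourSystem (φ p) (A p)) →
      -- the presentation, for every choice
      Presents A (rel1 A ∪ rel2 A ∪ rel3Right A ∪ rel4 A) ∧
      -- the presentation with `σ τ = ν α β`, for a choice that also represents the left orbits
      ((∀ p : S, IsLeftOrbitSystem ((p : Nat.Primes) : ℕ) (A p)) →
        Presents A (rel1 A ∪ rel2 A ∪ rel3Left A ∪ rel4 A)) := by
  refine ⟨⟨unitsBarEquiv S⟩, ncard_A0 S,
    fun p B => ⟨isNeighbourSystem_iff (φ p), fun hB => hB.ncard_eq⟩, ?_, fun A hA => ?_⟩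
  · choose A hA using fun p => exists_two_sided_system (φ p)
    exact ⟨A, hA⟩
  · have hA' : ∀ p : S, IsRightOrbitSystem ((p : Nat.Primes) : ℕ) (A p) :=
      fun p => (isNeighbourSystem_iff (φ p)).1 (hA p)
    exact ⟨presents_right hA' (exists_third_unit S),
      fun hL => presents_left hA' hL (exists_third_unit S)⟩
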